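/- Let $M$ be a smooth manifold of dimension $n\ge 3$ with a Finsler metric $F\colon TM\to[0,\infty)$: $F$ is continuous, smooth on the complement of the zero section, satisfies $F(tv)=tF(v)$ for $t>0$, and, with $E=\frac12F^2$, the matrix $g_{ij}=\frac{\partial^2E}{\partial y^i\partial y^j}$ is positive definite at every nonzero tangent vector. Here $(x^i,y^i)$ are the coordinates of $TM$ induced by local coordinates $(u^i)$ of $M$, $(g^{ij})$ is the inverse of $(g_{ij})$, and sums over repeated indices are understood. Let $$G^l=\tfrac12g^{lm}\Big(y^k\frac{\partial^2E}{\partial y^m\partial x^k}-\frac{\partial E}{\partial x^m}\Big),\qquad P^l_{ijk}=-\frac{\partial^3G^l}{\partial y^i\partial y^j\partial y^k}$$ be the geodesic spray coefficients and the mixed curvature of the Berwald connection of $F$. Let $\alpha\colon M\to\mathbb R$ be a smooth function, $\alpha_l=\frac{\partial\alpha}{\partial u^l}$, let $\tilde P^l_{ijk}$ be the mixed curvature of the conformally changed metric $\tilde F=e^{\alpha}F$, and put $$X^l=g^{lm}\alpha_m,\qquad X^l_s=\frac{\partial X^l}{\partial y^s}.$$ Let $p\in M$ be a point with $d_p\alpha\ne0$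 such that (i) the indicatrix $\{v\in T_pM: F(v)=1\}$, with the Riemannian metric induced by $g_{ij}$ on $T_pM\setminus\{0\}$, has positive sectional curvature, and (ii) $\tilde P^l_{ijk}\alpha_l=P^l_{ijk}\alpha_l$ at all nonzero $v\in T_pM$, for all $i,j,k$. Then both functions $$v\mapsto (X^l\alpha_l)(v)\qquad\text{and}\qquad v\mapsto F(v)\,(X^l_sX^s\alpha_l)(v)$$ are constant on the set of nonzero vectors of the hyperplane $T_pN=\{v\in T_pM: v(\alpha)=0\}$. -/

import Mathlib

open scoped Manifold ContDiff

noncomputable section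

namespace FinslerConformal

/-- Coordinate space `ℝⁿ`; it is also the model space of the manifolds below. -/
abbrev Coord (n : ℕ) : Type := EuclideanSpace ℝ (Fin n)

/-- The partial derivative `∂f/∂uⁱ` at `u`. -/
def pd {n : ℕ} (f : Coord n → ℝ) (i : Fin n) (u : Coord n) : ℝ :=
  fderiv ℝ f u (EuclideanSpace.single i 1)

/-! ### Sectional curvature of a metric tensor given in coordinates -/

section Curvature

variable {m : ℕ}

/-- Christoffel symbols `Γᶜₐᵦ` of the metric `h`. -/
def christoffel (h : Coord m → Matrix (Fin m) (Fin m) ℝ) (c a b : Fin m) (u : Coord m) : ℝ :=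
  (1 / 2) * ∑ d, (h u)⁻¹ c d *
    (pd (fun u' => h u' b d) a u + pd (fun u' => h u' a d) b u - pd (fun u' => h u' a b) d u)

/-- The components of the curvature tensor: `R(∂ₐ, ∂ᵦ)∂_c = ∑ d, (riemann h d c a b) ∂_d`, where
`R(X, Y)Z = ∇_X ∇_Y Z - ∇_Y ∇_X Z - ∇_[X,Y] Z` for the Levi-Civita connection of `h`. -/
def riemann (h : Coord m → Matrix (Fin m) (Fin m) ℝ) (d c a b : Fin m) (u : Coord m) : ℝ :=
  pd (christoffel h d b c) a u - pd (christoffel h d a c) b u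
    + ∑ e, (christoffel h d a e u * christoffel h e b c u
      - christoffel h d b e u * christoffel h e a c u)

/-- The scalar product `h_u(ξ, ζ)`. -/
def metricProd (h : Coord m → Matrix (Fin m) (Fin m) ℝ) (u ξ ζ : Coord m) : ℝ :=
  ∑ a, ∑ b, h u a b * ξ a * ζ b

/-- The sectional curvature `h(R(ξ, ζ)ζ, ξ) / (h(ξ, ξ) h(ζ, ζ) - h(ξ, ζ)²)` of the plane spanned by
the linearly independent vectors `ξ`, `ζ` at `u`. -/
def sectionalCurvature (h : Coord m → Matrix (Fin m) (Fin m) ℝ) (u ξ ζ : Coord m) : ℝ :=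
  (∑ a, ∑ b, ∑ c, ∑ d, ∑ e, h u d e * riemann h d c a b u * ξ a * ζ b * ζ c * ξ e) /
    (metricProd h u ξ ξ * metricProd h u ζ ζ - metricProd h u ξ ζ ^ 2)

end Curvature

/-! ### A single tangent space: energy, Riemann-Finsler metric, indicatrix -/

section Vertical

variable {n : ℕ}

/-- The energy `E = (1/2) F²` of a function `L` on a tangent space. -/
def energy (L : Coord n → ℝ) (y : Coord n) : ℝ := (1 / 2) * L y ^ 2

/-- The Riemann-Finsler metric `g_ij = ∂²E/∂yⁱ∂yʲ`. -/
def gMatrix (L : Coord n → ℝ) (y : Coord n) : Matrix (Fin n) (Fin n) ℝ :=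
  Matrix.of fun i j => pd (pd (energy L) i) j y

/-- `r` is a smooth regular parametrization, over the open set `U ⊆ ℝⁿ⁻¹`, of a piece of the
indicatrix hypersurface `{y | L y = 1}`. -/
structure IsIndicatrixParam (L : Coord n → ℝ) (U : Set (Coord (n - 1)))
    (r : Coord (n - 1) → Coord n) : Prop where
  isOpen : IsOpen U
  smooth : ContDiffOn ℝ ∞ r U
  immersion : ∀ u ∈ U, Function.Injective (fderiv ℝ r u)
  mem : ∀ u ∈ U, L (r u) = 1

/-- The Riemannian metric induced by `g_ij` on a parametrized piece of the indicatrix. -/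
def inducedMetric (L : Coord n → ℝ) (r : Coord (n - 1) → Coord n) (u : Coord (n - 1)) :
    Matrix (Fin (n - 1)) (Fin (n - 1)) ℝ :=
  Matrix.of fun a b => ∑ i, ∑ j, gMatrix L (r u) i j *
    pd (fun u' => r u' i) a u * pd (fun u' => r u' j) b u

/-- The indicatrix hypersurface `{y | L y = 1}`, as a Riemannian submanifold of `ℝⁿ \ {0}` with the
metric `g_ij`, has positive sectional curvature at all of its points. -/
def IndicatrixPositivelyCurved (L : Coord n → ℝ) : Prop :=
  ∀ (U : Set (Coord (n - 1))) (r : Coord (n - 1) → Coord n), IsIndicatrixParam L U r →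
    ∀ u ∈ U, ∀ ξ ζ : Coord (n - 1), LinearIndependent ℝ ![ξ, ζ] →
      0 < sectionalCurvature (inducedMetric L r) u ξ ζ

/-- `Xˡ = gˡᵐ αₘ`, the components of the gradient-type vector field of the covector `a = (αₘ)`. -/
def gradX (L : Coord n → ℝ) (a : Fin n → ℝ) (l : Fin n) (y : Coord n) : ℝ :=
  ∑ k, (gMatrix L y)⁻¹ l k * a k

/-- `Xˡ αₗ`. -/
def gradSq (L : Coord n → ℝ) (a : Fin n → ℝ) (y : Coord n) : ℝ :=
  ∑ l, gradX L a l y * a l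

/-- `Xˡₛ Xˢ αₗ`, where `Xˡₛ = ∂Xˡ/∂yˢ`. -/
def gradDeriv (L : Coord n → ℝ) (a : Fin n → ℝ) (y : Coord n) : ℝ :=
  ∑ l, ∑ s, pd (gradX L a l) s y * gradX L a s y * a l

end Vertical

/-! ### Spray coefficients and mixed curvature in induced coordinates `(x, y)` -/

section Spray

variable {n : ℕ}

/-- Geodesic spray coefficients
`Gˡ = (1/2) gˡᵐ (yᵏ ∂²E/∂yᵐ∂xᵏ - ∂E/∂xᵐ)` of the function `K (x, y)`. -/
def spray (K : Coord n → Coord n → ℝ) (l : Fin n) (x y : Coord n) : ℝ :=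
  (1 / 2) * ∑ m, (gMatrix (K x) y)⁻¹ l m *
    ((∑ k, y k * pd (fun y' => pd (fun x' => energy (K x') y') k x) m y)
      - pd (fun x' => energy (K x') y) m x)

/-- The mixed curvature of the Berwald connection,
`Pˡ_ijk = - Gˡ_ijk = - ∂³Gˡ/∂yⁱ∂yʲ∂yᵏ`. -/
def mixedCurvature (K : Coord n → Coord n → ℝ) (l i j k : Fin n) (x y : Coord n) : ℝ :=
  - pd (pd (pd (spray K l x) i) j) k y

end Spray

/-! ### Finsler manifolds -/

section Manifold

variable {n : ℕ} {M : Type*} [TopologicalSpace M] [ChartedSpace (Coord n) M]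

/-- The restriction of `F` to the tangent space at `q` (which is `ℝⁿ` as a vector space). -/
def fiber [IsManifold (𝓡 n) ∞ M] (F : TangentBundle (𝓡 n) M → ℝ) (q : M) (v : Coord n) : ℝ :=
  F ⟨q, (v : TangentSpace (𝓡 n) q)⟩

/-- Finsler metrics on `M`. -/
structure IsFinslerMetric [IsManifold (𝓡 n) ∞ M] (F : TangentBundle (𝓡 n) M → ℝ) : Prop where
  continuous : Continuous F
  nonneg : ∀ v, 0 ≤ F v
  smooth : ContMDiffOn (𝓡 n).tangent 𝓘(ℝ, ℝ) ∞ F {v | v.2 ≠ 0}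
  homogeneous : ∀ (q : M) (v : TangentSpace (𝓡 n) q) (t : ℝ), 0 < t →
    F ⟨q, t • v⟩ = t * F ⟨q, v⟩
  strongly_convex : ∀ (q : M) (v : Coord n), v ≠ 0 → (gMatrix (fiber F q) v).PosDef

/-- The conformal change `e^α F`. -/
def conformal (α : M → ℝ) (F : TangentBundle (𝓡 n) M → ℝ) (v : TangentBundle (𝓡 n) M) : ℝ :=
  Real.exp (α v.proj) * F v

/-- The coordinate expression of `F` in the coordinates `(x, y)` of the tangent manifold induced by
the chart `φ`: the vector with coordinates `(x, y)` is `yⁱ ∂/∂uⁱ` at `φ⁻¹ x`. -/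
def inCoords (φ : OpenPartialHomeomorph M (Coord n)) (F : TangentBundle (𝓡 n) M → ℝ)
    (x y : Coord n) : ℝ :=
  F ⟨φ.symm x, mfderiv (𝓡 n) (𝓡 n) φ.symm x y⟩

/-- The partial derivatives `αₗ = ∂α/∂uˡ` at `q` in the chart `φ`. -/
def dCoords (φ : OpenPartialHomeomorph M (Coord n)) (α : M → ℝ) (q : M) (l : Fin n) : ℝ :=
  pd (fun x => α (φ.symm x)) l (φ q)

/-- The coordinates `(yⁱ)` in the chart `φ` of a tangent vector `v` at `q`. -/
def vecCoords (φ : OpenPartialHomeomorph M (Coord n)) (q : M) (v : TangentSpace (𝓡 n) q) :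
    Coord n :=
  mfderiv (𝓡 n) (𝓡 n) φ q v

end Manifold

end FinslerConformal

end

open FinslerConformal

/-!
Fix the tangent space at `p`, with energy `E = F² / 2`, `g = D²E`, `a = dα` and `X = g⁻¹ a`.

The conformal change adds `a(y) y - E X` to the spray, so by hypothesis (ii) the third derivatives
of `a(y)² - E a(X)` vanish. Being homogeneous of degree two, this function is a quadratic form, and
hence so is `E a(X) = q(y, y)`, which is positive definite.

Let `B` generate isometries of `q` that preserve `a`, and let `f = DE(B y)`. Differentiating
`E a(X) = q` along `B` gives `E D²f(X, X) = f a(X)`. Where `(f + ε a²) / E` is maximal, its second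
derivative along `X` is nonpositive, that is, `2 E a(X) ≤ a(y)²`; so equality holds in the
Cauchy–Schwarz inequality, `X` is radial, and `f = DE(B y)` vanishes because `a(B y)` does. Hence
`f ≤ ε E max (a² / E)` everywhere, and letting `ε → 0`, for both `B` and `-B`, yields `f = 0`.

Thus `E` is invariant under `B`, and `DX(B y) = B X`. It follows that the 0-homogeneous functions
`a(X)` and `q(y, X) / F`, the second of which is `F a(DX(X)) / 4` on the kernel of `a`, are
invariant as well. The vectors `B y` fill the `q`-orthogonal complement of `y` in this kernel, and
for `n ≥ 3` the kernel without the origin is connected, so both functions are constant there.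
-/

namespace FinslerConformal

section SmoothOff

variable {V W Z : Type*} [NormedAddCommGroup V] [NormedSpace ℝ V]
  [NormedAddCommGroup W] [NormedSpace ℝ W] [NormedAddCommGroup Z] [NormedSpace ℝ Z]

/-- Smoothness away from the origin, the regularity of a Finsler metric on a tangent space. -/
def SmoothOff (f : V → W) : Prop :=
  ∀ y, y ≠ 0 → ContDiffAt ℝ ∞ f y

theorem eventuallyEq_of_eq_off_zero {V W : Type*} [TopologicalSpace V] [T1Space V] [Zero V]
    {f g : V → W} (h : ∀ z, z ≠ 0 → f z = g z) {y : V} (hy : y ≠ 0) : f =ᶠ[nhds y] g :=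
  (isOpen_ne.eventually_mem hy).mono h

theorem fderiv_congr_off_zero {f g : V → W} (h : ∀ z, z ≠ 0 → f z = g z) {y : V} (hy : y ≠ 0) :
    fderiv ℝ f y = fderiv ℝ g y :=
  (eventuallyEq_of_eq_off_zero h hy).fderiv_eq

namespace SmoothOff

theorem const (c : W) : SmoothOff fun _ : V => c := fun _ _ => contDiffAt_const

theorem of_clm (B : V →L[ℝ] W) : SmoothOff B := fun _ _ => B.contDiff.contDiffAt

variable {f g : V → W}

theorem differentiableAt (hf : SmoothOff f) {y : V} (hy : y ≠ 0) : DifferentiableAt ℝ f y :=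
  (hf y hy).differentiableAt (by simp)

theorem congr (hf : SmoothOff f) (h : ∀ y, y ≠ 0 → g y = f y) : SmoothOff g := fun y hy =>
  (hf y hy).congr_of_eventuallyEq (eventuallyEq_of_eq_off_zero h hy)

theorem fderiv_right (hf : SmoothOff f) : SmoothOff (fderiv ℝ f) := fun y hy =>
  (hf y hy).fderiv_right (by simp)

theorem add (hf : SmoothOff f) (hg : SmoothOff g) : SmoothOff fun y => f y + g y :=
  fun y hy => (hf y hy).add (hg y hy)

theorem sub (hf : SmoothOff f) (hg : SmoothOff g) : SmoothOff fun y => f y - g y :=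
  fun y hy => (hf y hy).sub (hg y hy)

theorem mul {f g : V → ℝ} (hf : SmoothOff f) (hg : SmoothOff g) : SmoothOff fun y => f y * g y :=
  fun y hy => (hf y hy).mul (hg y hy)

theorem clm_apply {c : V → W →L[ℝ] Z} {u : V → W} (hc : SmoothOff c) (hu : SmoothOff u) :
    SmoothOff fun y => c y (u y) :=
  fun y hy => (hc y hy).clm_apply (hu y hy)

theorem fderiv_clm_apply {c : V → W →L[ℝ] Z} {u : V → W} (hc : SmoothOff c) (hu : SmoothOff u)
    {y : V} (hy : y ≠ 0) (v : V) :
    fderiv ℝ (fun z => c z (u z)) y v = fderiv ℝ c y v (u y) + c y (fderiv ℝ u y v) := by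
  rw [_root_.fderiv_clm_apply (hc.differentiableAt hy) (hu.differentiableAt hy)]
  simp [add_comm]

theorem fderiv_clm_apply_const {c : V → W →L[ℝ] Z} (hc : SmoothOff c) {y : V} (hy : y ≠ 0)
    (v : V) (w : W) : fderiv ℝ (fun z => c z w) y v = fderiv ℝ c y v w := by
  simp [hc.fderiv_clm_apply (const w) hy]

theorem fderiv_fderiv_add (hf : SmoothOff f) (hg : SmoothOff g) {y : V}
    (hy : y ≠ 0) :
    fderiv ℝ (fderiv ℝ fun z => f z + g z) y
      = fderiv ℝ (fderiv ℝ f) y + fderiv ℝ (fderiv ℝ g) y := by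
  rw [fderiv_congr_off_zero (fun z hz => fderiv_fun_add (hf.differentiableAt hz)
    (hg.differentiableAt hz)) hy]
  exact fderiv_fun_add (hf.fderiv_right.differentiableAt hy) (hg.fderiv_right.differentiableAt hy)

theorem fderiv_fderiv_fderiv_add (hf : SmoothOff f) (hg : SmoothOff g) {y : V}
    (hy : y ≠ 0) :
    fderiv ℝ (fderiv ℝ (fderiv ℝ fun z => f z + g z)) y
      = fderiv ℝ (fderiv ℝ (fderiv ℝ f)) y + fderiv ℝ (fderiv ℝ (fderiv ℝ g)) y := by
  rw [fderiv_congr_off_zero (fun z hz => hf.fderiv_fderiv_add hg hz) hy]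
  exact fderiv_fun_add (hf.fderiv_right.fderiv_right.differentiableAt hy)
    (hg.fderiv_right.fderiv_right.differentiableAt hy)

theorem fderiv_fderiv_const_mul {f : V → ℝ} (hf : SmoothOff f) (c : ℝ) {y : V} (hy : y ≠ 0) :
    fderiv ℝ (fderiv ℝ fun z => c * f z) y = c • fderiv ℝ (fderiv ℝ f) y := by
  rw [fderiv_congr_off_zero (fun z hz => fderiv_const_mul (hf.differentiableAt hz) c) hy]
  exact fderiv_const_smul (hf.fderiv_right.differentiableAt hy) c

theorem fderiv_clm (hf : SmoothOff f) (A : W →L[ℝ] Z) {y : V} (hy : y ≠ 0) :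
    fderiv ℝ (fun z => A (f z)) y = A.comp (fderiv ℝ f y) :=
  (A.hasFDerivAt.comp y (hf.differentiableAt hy).hasFDerivAt).fderiv

theorem fderiv_fderiv_clm (hf : SmoothOff f) (A : W →L[ℝ] Z) {y : V} (hy : y ≠ 0) (u v : V) :
    fderiv ℝ (fderiv ℝ fun z => A (f z)) y u v = A (fderiv ℝ (fderiv ℝ f) y u v) := by
  rw [fderiv_congr_off_zero (fun z hz => hf.fderiv_clm A hz) hy]
  exact congrArg (· u v) (hf.fderiv_right.fderiv_clm (ContinuousLinearMap.compL ℝ V W Z A) hy)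

theorem fderiv_fderiv_fderiv_clm (hf : SmoothOff f) (A : W →L[ℝ] Z) {y : V} (hy : y ≠ 0)
    (u v w : V) :
    fderiv ℝ (fderiv ℝ (fderiv ℝ fun z => A (f z))) y u v w
      = A (fderiv ℝ (fderiv ℝ (fderiv ℝ f)) y u v w) := by
  have hD := (fderiv_congr_off_zero (y := y) (fun z hz => fderiv_congr_off_zero
    (fun z hz => hf.fderiv_clm A hz) hz) hy)
  rw [hD]
  exact congrArg (· w)
    (hf.fderiv_right.fderiv_fderiv_clm (ContinuousLinearMap.compL ℝ V W Z A) hy u v)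

theorem comp_equiv {g : W → Z} (hg : SmoothOff g) (T : V ≃L[ℝ] W) : SmoothOff (g ∘ T) :=
  fun y hy => (hg _ ((map_ne_zero_iff T T.injective).2 hy)).comp y T.contDiff.contDiffAt

theorem fderiv_fderiv_comp_equiv {g : W → Z} (hg : SmoothOff g) (T : V ≃L[ℝ] W) {y : V}
    (hy : y ≠ 0) (u v : V) :
    fderiv ℝ (fderiv ℝ (g ∘ T)) y u v = fderiv ℝ (fderiv ℝ g) (T y) (T u) (T v) := by
  rw [← (hg.comp_equiv T).fderiv_right.fderiv_clm_apply_const hy,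
    ← hg.fderiv_right.fderiv_clm_apply_const ((map_ne_zero_iff T T.injective).2 hy)]
  simp only [T.comp_right_fderiv, ContinuousLinearMap.comp_apply, ContinuousLinearEquiv.coe_coe]
  exact DFunLike.congr_fun (T.comp_right_fderiv (f := fun z => fderiv ℝ g z (T v)) (x := y)) u

theorem fderiv_fderiv_comm (hf : SmoothOff f) {y : V} (hy : y ≠ 0) (u v : V) :
    fderiv ℝ (fderiv ℝ f) y u v = fderiv ℝ (fderiv ℝ f) y v u :=
  (hf y hy).isSymmSndFDerivAt (by simpa using ENat.LEInfty.out) u v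

theorem fderiv_fderiv_fderiv_comm (hf : SmoothOff f) {y : V} (hy : y ≠ 0) (u v w : V) :
    fderiv ℝ (fderiv ℝ (fderiv ℝ f)) y u v w = fderiv ℝ (fderiv ℝ (fderiv ℝ f)) y u w v := by
  have hD := hf.fderiv_right.fderiv_right
  have expand (v w : V) : fderiv ℝ (fun z => fderiv ℝ (fderiv ℝ f) z v w) y u
      = fderiv ℝ (fderiv ℝ (fderiv ℝ f)) y u v w := by
    rw [fderiv_clm_apply_const (hD.clm_apply (const v)) hy, hD.fderiv_clm_apply_const hy]
  rw [← expand, ← expand,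
    fderiv_congr_off_zero (fun z hz => hf.fderiv_fderiv_comm hz v w) hy]

end SmoothOff

end SmoothOff

section PosHomogeneous

variable {V W : Type*} [NormedAddCommGroup V] [NormedSpace ℝ V]
  [NormedAddCommGroup W] [NormedSpace ℝ W]

/-- Positive homogeneity of degree `r` away from the origin. -/
def IsPosHomogeneous (r : ℕ) (f : V → W) : Prop :=
  ∀ y, y ≠ 0 → ∀ t : ℝ, 0 < t → f (t • y) = t ^ r • f y

namespace IsPosHomogeneous

variable {r : ℕ} {f : V → W}

theorem add {g : V → W} (hf : IsPosHomogeneous r f) (hg : IsPosHomogeneous r g) :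
    IsPosHomogeneous r fun y => f y + g y := fun y hy t ht => by
  simp only [hf y hy t ht, hg y hy t ht, smul_add]

theorem div {f g : V → ℝ} (hf : IsPosHomogeneous r f) (hg : IsPosHomogeneous r g) :
    IsPosHomogeneous 0 fun y => f y / g y := fun y hy t ht => by
  have htr : t ^ r ≠ 0 := (pow_pos ht r).ne'
  simp only [hf y hy t ht, hg y hy t ht, smul_eq_mul, mul_div_mul_left _ _ htr, pow_zero, one_mul]

theorem fderiv_right (h : IsPosHomogeneous (r + 1) f) (hf : SmoothOff f) :
    IsPosHomogeneous r (fderiv ℝ f) := fun y hy t ht => by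
  have hcomp : fderiv ℝ (fun z => f (t • z)) y = t • fderiv ℝ f (t • y) := fderiv_comp_smul t
  have hscale : fderiv ℝ (fun z => f (t • z)) y = t ^ (r + 1) • fderiv ℝ f y := by
    rw [fderiv_congr_off_zero (fun z hz => h z hz t ht) hy]
    exact fderiv_const_smul (hf.differentiableAt hy) _
  refine smul_right_injective _ ht.ne' ?_
  simp only [← hcomp, hscale, pow_succ', mul_smul]

theorem fderiv_apply_self (h : IsPosHomogeneous r f) {y : V} (hy : y ≠ 0)
    (hf : DifferentiableAt ℝ f y) : fderiv ℝ f y y = (r : ℝ) • f y := by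
  have hline : HasDerivAt (fun t : ℝ => t • y) y 1 := by
    simpa using (hasDerivAt_id (1 : ℝ)).smul_const y
  have hchain : HasDerivAt (fun t : ℝ => f (t • y)) (fderiv ℝ f y y) 1 :=
    HasFDerivAt.comp_hasDerivAt 1 (by simpa using hf.hasFDerivAt) hline
  have hpow : HasDerivAt (fun t : ℝ => t ^ r • f y) ((r : ℝ) • f y) 1 := by
    simpa using (hasDerivAt_pow r (1 : ℝ)).smul_const (f y)
  exact hchain.unique
    (hpow.congr_of_eventuallyEq ((lt_mem_nhds zero_lt_one).mono fun t ht => h y hy t ht))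

theorem exists_forall_le [FiniteDimensional ℝ V] [Nontrivial V] {g : V → ℝ}
    (hg : IsPosHomogeneous 0 g) (hcont : ContinuousOn g {0}ᶜ) :
    ∃ z, z ≠ 0 ∧ ∀ y, y ≠ 0 → g y ≤ g z := by
  have := FiniteDimensional.proper ℝ V
  have hsphere : ∀ z ∈ Metric.sphere (0 : V) 1, z ≠ 0 := fun z hz =>
    Metric.ne_of_mem_sphere hz one_ne_zero
  obtain ⟨z, hz, hmax⟩ := (isCompact_sphere (0 : V) 1).exists_isMaxOn
    (NormedSpace.sphere_nonempty.2 zero_le_one) (hcont.mono hsphere)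
  refine ⟨z, hsphere z hz, fun y hy => ?_⟩
  have hscale := hg y hy ‖y‖⁻¹ (by positivity)
  rw [pow_zero, one_smul] at hscale
  rw [← hscale]
  exact hmax (by simp [norm_smul, hy])

end IsPosHomogeneous

end PosHomogeneous

section LocalMax

theorem deriv_deriv_nonpos_of_isLocalMax {f : ℝ → ℝ} {x : ℝ} (hf : ContinuousAt f x)
    (hmax : IsLocalMax f x) : deriv (deriv f) x ≤ 0 := by
  by_contra! hpos
  have hmin := isLocalMin_of_deriv_deriv_pos hpos hmax.deriv_eq_zero hf
  have hconst : f =ᶠ[nhds x] fun _ => f x := by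
    filter_upwards [hmin, hmax] with t using fun h₁ h₂ => le_antisymm h₂ h₁
  have hzero : deriv (deriv f) x = 0 := by
    rw [hconst.deriv.deriv_eq]
    simp
  exact hpos.ne' hzero

theorem fderiv_fderiv_nonpos_of_isLocalMax {V : Type*} [NormedAddCommGroup V] [NormedSpace ℝ V]
    {f : V → ℝ} {y : V} (hf : ContDiffAt ℝ 2 f y) (hmax : IsLocalMax f y) (v : V) :
    fderiv ℝ (fderiv ℝ f) y v v ≤ 0 := by
  have hline (t : ℝ) : HasDerivAt (fun t : ℝ => y + t • v) v t := by
    simpa using ((hasDerivAt_id t).smul_const v).const_add y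
  have htendsto : Filter.Tendsto (fun t : ℝ => y + t • v) (nhds 0) (nhds y) := by
    simpa using (hline 0).continuousAt.tendsto
  have hdiff : ∀ᶠ z in nhds y, DifferentiableAt ℝ f z :=
    (hf.eventually (by simp)).mono fun z hz => hz.differentiableAt (by simp)
  have hderiv : deriv (fun t : ℝ => f (y + t • v)) =ᶠ[nhds 0]
      fun t => fderiv ℝ f (y + t • v) v :=
    (htendsto.eventually hdiff).mono fun t ht =>
      (ht.hasFDerivAt.comp_hasDerivAt t (hline t)).deriv
  have hdiff₂ : DifferentiableAt ℝ (fderiv ℝ f) (y + (0 : ℝ) • v) := by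
    rw [zero_smul, add_zero]
    exact (hf.fderiv_right (m := 1) (by norm_num)).differentiableAt (by simp)
  have hfderiv : HasDerivAt (fun t : ℝ => fderiv ℝ f (y + t • v))
      (fderiv ℝ (fderiv ℝ f) (y + (0 : ℝ) • v) v) 0 :=
    hdiff₂.hasFDerivAt.comp_hasDerivAt 0 (hline 0)
  have hderiv₂ : deriv (deriv fun t : ℝ => f (y + t • v)) 0 = fderiv ℝ (fderiv ℝ f) y v v := by
    rw [hderiv.deriv_eq]
    simpa using (hfderiv.clm_apply (hasDerivAt_const 0 v)).deriv
  rw [← hderiv₂]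
  refine deriv_deriv_nonpos_of_isLocalMax ?_ ?_
  · exact ContinuousAt.comp (g := f) (by simpa using hf.continuousAt) (hline 0).continuousAt
  · have : ∀ᶠ t in nhds (0 : ℝ), f (y + t • v) ≤ f y := htendsto.eventually hmax
    simpa [IsLocalMax, IsMaxFilter] using this

end LocalMax

section LieDerivative

variable {V W : Type*} [NormedAddCommGroup V] [NormedSpace ℝ V]
  [NormedAddCommGroup W] [NormedSpace ℝ W] {f : V → W} (B : V →L[ℝ] V)

/-- The derivative of `f` along the linear vector field `y ↦ B y`. -/
noncomputable def lieDeriv (B : V →L[ℝ] V) (f : V → W) (y : V) : W :=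
  fderiv ℝ f y (B y)

theorem SmoothOff.lieDeriv_right (hf : SmoothOff f) : SmoothOff (lieDeriv B f) :=
  hf.fderiv_right.clm_apply (SmoothOff.of_clm B)

theorem IsPosHomogeneous.lieDeriv_right {r : ℕ} (h : IsPosHomogeneous (r + 1) f)
    (hf : SmoothOff f) : IsPosHomogeneous (r + 1) (lieDeriv B f) := fun y hy t ht => by
  rw [lieDeriv, h.fderiv_right hf y hy t ht]
  simp only [map_smul, smul_apply, lieDeriv, smul_smul, pow_succ']

theorem fderiv_lieDeriv (hf : SmoothOff f) {y : V} (hy : y ≠ 0) (u : V) :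
    fderiv ℝ (lieDeriv B f) y u = fderiv ℝ (fderiv ℝ f) y u (B y) + fderiv ℝ f y (B u) := by
  have hproduct := hf.fderiv_right.fderiv_clm_apply (SmoothOff.of_clm B) hy u
  rwa [B.fderiv] at hproduct

theorem fderiv_fderiv_lieDeriv (hf : SmoothOff f) {y : V} (hy : y ≠ 0) (u v : V) :
    fderiv ℝ (fderiv ℝ (lieDeriv B f)) y u v
      = fderiv ℝ (fderiv ℝ (fderiv ℝ f)) y u v (B y) + fderiv ℝ (fderiv ℝ f) y v (B u)
        + fderiv ℝ (fderiv ℝ f) y u (B v) := by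
  have hD := hf.fderiv_right.fderiv_right
  have hv := hD.clm_apply (SmoothOff.const v)
  rw [← (hf.lieDeriv_right B).fderiv_right.fderiv_clm_apply_const hy,
    fderiv_congr_off_zero (fun z hz => fderiv_lieDeriv B hf hz v) hy,
    fderiv_fun_add ((hv.clm_apply (SmoothOff.of_clm B)).differentiableAt hy)
      ((hf.fderiv_right.clm_apply (SmoothOff.const (B v))).differentiableAt hy),
    add_apply, hv.fderiv_clm_apply (SmoothOff.of_clm B) hy,
    hf.fderiv_right.fderiv_clm_apply_const hy, hD.fderiv_clm_apply_const hy, B.fderiv]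

end LieDerivative

section QuadraticForm

variable {V : Type*} [NormedAddCommGroup V] [NormedSpace ℝ V]

/-- Away from the origin `f` is the quadratic form of the symmetric bilinear form `q`. -/
structure IsPolarization (q : V →L[ℝ] V →L[ℝ] ℝ) (f : V → ℝ) : Prop where
  symm : ∀ u v, q u v = q v u
  eq_apply_self : ∀ y, y ≠ 0 → f y = q y y

theorem IsPolarization.fderiv_apply {q : V →L[ℝ] V →L[ℝ] ℝ} {f : V → ℝ}
    (h : IsPolarization q f) {y : V} (hy : y ≠ 0) (u : V) : fderiv ℝ f y u = 2 * q y u := by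
  have hproduct := (SmoothOff.of_clm q).fderiv_clm_apply (SmoothOff.of_clm (.id ℝ V)) hy u
  rw [q.fderiv, ContinuousLinearMap.fderiv, ContinuousLinearMap.id_apply,
    ContinuousLinearMap.id_apply, h.symm u y] at hproduct
  rw [fderiv_congr_off_zero h.eq_apply_self hy, two_mul]
  exact hproduct

theorem IsPolarization.fderiv_fderiv_apply {q : V →L[ℝ] V →L[ℝ] ℝ} {f : V → ℝ}
    (h : IsPolarization q f) {y : V} (hy : y ≠ 0) (u v : V) :
    fderiv ℝ (fderiv ℝ f) y u v = 2 * q u v := by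
  have hderiv (z : V) (hz : z ≠ 0) : fderiv ℝ f z = ((2 : ℝ) • q) z := by
    ext w
    exact h.fderiv_apply hz w
  rw [fderiv_congr_off_zero hderiv hy, ContinuousLinearMap.fderiv]
  rfl

theorem isPreconnected_compl_zero (hV : 1 < Module.finrank ℝ V) :
    IsPreconnected ({0}ᶜ : Set V) :=
  (isConnected_compl_singleton_of_one_lt_rank (Module.one_lt_rank_of_one_lt_finrank hV)
    0).isPreconnected

theorem exists_isPolarization_of_fderiv_fderiv_fderiv_eq_zero (hV : 1 < Module.finrank ℝ V)
    {f : V → ℝ} (hf : SmoothOff f) (hhom : IsPosHomogeneous 2 f)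
    (hthird : ∀ y, y ≠ 0 → fderiv ℝ (fderiv ℝ (fderiv ℝ f)) y = 0) :
    ∃ q : V →L[ℝ] V →L[ℝ] ℝ, IsPolarization q f := by
  obtain ⟨b, hb⟩ := isOpen_compl_singleton.exists_is_const_of_fderiv_eq_zero (𝕜 := ℝ)
    (isPreconnected_compl_zero hV)
    (fun z hz => (hf.fderiv_right.fderiv_right.differentiableAt hz).differentiableWithinAt) hthird
  have : Nontrivial V := Module.nontrivial_of_finrank_pos (R := ℝ) (by lia)
  obtain ⟨z, hz⟩ := exists_ne (0 : V)
  refine ⟨(1 / 2 : ℝ) • b, fun u v => ?_, fun y hy => ?_⟩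
  · simp [← hb z hz, hf.fderiv_fderiv_comm hz u v]
  · have heuler₂ := (hhom.fderiv_right hf).fderiv_apply_self hy
      (hf.fderiv_right.differentiableAt hy)
    have heuler := hhom.fderiv_apply_self hy (hf.differentiableAt hy)
    rw [hb y hy] at heuler₂
    simp [heuler₂, heuler]

/-- `B` generates linear isometries of the quadratic form `q` that preserve the covector `a`. -/
structure IsInfinitesimalIsometry (q : V →L[ℝ] V →L[ℝ] ℝ) (a : V →L[ℝ] ℝ) (B : V →L[ℝ] V) :
    Prop where
  map_apply : ∀ v, a (B v) = 0
  apply_self : ∀ v, q v (B v) = 0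

namespace IsInfinitesimalIsometry

variable {q : V →L[ℝ] V →L[ℝ] ℝ} {a : V →L[ℝ] ℝ} {B : V →L[ℝ] V}

theorem neg (hB : IsInfinitesimalIsometry q a B) : IsInfinitesimalIsometry q a (-B) where
  map_apply v := by simp [hB.map_apply]
  apply_self v := by simp [hB.apply_self]

theorem apply_add_apply (hB : IsInfinitesimalIsometry q a B) (u v : V) :
    q u (B v) + q v (B u) = 0 := by
  simpa [hB.apply_self] using hB.apply_self (u + v)

end IsInfinitesimalIsometry

/-- The witness rotates the `q`-orthogonal plane spanned by `y` and `v`. -/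
theorem exists_isInfinitesimalIsometry_apply_eq {q : V →L[ℝ] V →L[ℝ] ℝ} {a : V →L[ℝ] ℝ}
    (hq : ∀ u v, q u v = q v u) {y v : V} (hqy : q y y ≠ 0) (hay : a y = 0) (hav : a v = 0)
    (hyv : q y v = 0) : ∃ B, IsInfinitesimalIsometry q a B ∧ B y = v := by
  refine ⟨(q y y)⁻¹ • ((q y).smulRight v - (q v).smulRight y), ⟨fun u => ?_, fun u => ?_⟩, ?_⟩
  · simp [hay, hav]
  · simp only [smul_apply, sub_apply, ContinuousLinearMap.smulRight_apply, map_smul, map_sub,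
      smul_eq_mul, hq u v, hq u y]
    ring
  · simp [hq v y, hyv, hqy]

theorem exists_eq_on_ker_of_fderiv_eq_zero (hV : 3 ≤ Module.finrank ℝ V)
    (a : V →L[ℝ] ℝ) {h : V → ℝ} (hh : SmoothOff h)
    (hzero : ∀ y, y ≠ 0 → a y = 0 → ∀ v, a v = 0 → fderiv ℝ h y v = 0) :
    ∃ c : ℝ, ∀ y, y ≠ 0 → a y = 0 → h y = c := by
  have : FiniteDimensional ℝ V := .of_finrank_pos (by lia)
  let K : Submodule ℝ V := LinearMap.ker (a : V →ₗ[ℝ] ℝ)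
  have hK : 1 < Module.finrank ℝ K := by
    have hsum := LinearMap.finrank_range_add_finrank_ker (a : V →ₗ[ℝ] ℝ)
    have hrange : Module.finrank ℝ (LinearMap.range (a : V →ₗ[ℝ] ℝ)) ≤ 1 := by
      simpa using Submodule.finrank_le (LinearMap.range (a : V →ₗ[ℝ] ℝ))
    change _ + Module.finrank ℝ K = _ at hsum
    lia
  have hderiv (w : K) (hw : w ≠ 0) : HasFDerivAt (fun w : K => h w) (0 : K →L[ℝ] ℝ) w := by
    have hw' : (w : V) ≠ 0 := by simpa using hw
    refine ((hh.differentiableAt hw').hasFDerivAt.comp w K.subtypeL.hasFDerivAt).congr_fderiv ?_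
    ext v
    exact hzero w hw' w.2 v v.2
  obtain ⟨c, hc⟩ := isOpen_compl_singleton.exists_is_const_of_fderiv_eq_zero (𝕜 := ℝ)
    (isPreconnected_compl_zero hK)
    (fun w hw => (hderiv w hw).differentiableAt.differentiableWithinAt)
    (fun w hw => (hderiv w hw).fderiv)
  exact ⟨c, fun y hy hay => hc ⟨y, hay⟩ (by simpa [Subtype.ext_iff] using hy)⟩

theorem exists_eq_on_ker_of_lieDeriv_eq_zero (hV : 3 ≤ Module.finrank ℝ V)
    {q : V →L[ℝ] V →L[ℝ] ℝ} {a : V →L[ℝ] ℝ}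
    (hq : ∀ u v, q u v = q v u) (hqpos : ∀ y, y ≠ 0 → 0 < q y y) {h : V → ℝ} (hh : SmoothOff h)
    (hhom : IsPosHomogeneous 0 h)
    (hlie : ∀ B, IsInfinitesimalIsometry q a B → ∀ y, y ≠ 0 → a y = 0 → lieDeriv B h y = 0) :
    ∃ c : ℝ, ∀ y, y ≠ 0 → a y = 0 → h y = c := by
  refine exists_eq_on_ker_of_fderiv_eq_zero hV a hh fun y hy hay v hav => ?_
  have hqy : q y y ≠ 0 := (hqpos y hy).ne'
  obtain ⟨B, hB, hBy⟩ := exists_isInfinitesimalIsometry_apply_eq hq hqy hay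
    (v := v - (q y v / q y y) • y) (by simp [hay, hav]) (by simp [hqy])
  have horth := hlie B hB y hy hay
  have hradial : fderiv ℝ h y y = 0 := by
    simpa using hhom.fderiv_apply_self hy (hh.differentiableAt hy)
  rwa [lieDeriv, hBy, map_sub, map_smul, hradial, smul_zero, sub_zero] at horth

end QuadraticForm

section Minkowski

variable {V : Type*} [NormedAddCommGroup V] [NormedSpace ℝ V]

/-- The energies `E = F² / 2` of Minkowski norms, the functions that a Finsler metric induces on
the tangent spaces. -/
structure IsMinkowskiEnergy (E : V → ℝ) : Prop where
  smooth : SmoothOff E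
  homogeneous : IsPosHomogeneous 2 E
  posDef : ∀ y, y ≠ 0 → ∀ v, v ≠ 0 → 0 < fderiv ℝ (fderiv ℝ E) y v v

/-- `X` is the gradient of the covector `a` with respect to the Hessian metric of `E`. -/
structure IsGradient (E : V → ℝ) (a : V →L[ℝ] ℝ) (X : V → V) : Prop where
  smooth : SmoothOff X
  hess_apply : ∀ y, y ≠ 0 → fderiv ℝ (fderiv ℝ E) y (X y) = a

namespace IsMinkowskiEnergy

variable {E : V → ℝ} (hE : IsMinkowskiEnergy E)
include hE

theorem hess_apply_self {y : V} (hy : y ≠ 0) : fderiv ℝ (fderiv ℝ E) y y = fderiv ℝ E y := by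
  simpa using (hE.homogeneous.fderiv_right hE.smooth).fderiv_apply_self hy
    (hE.smooth.fderiv_right.differentiableAt hy)

theorem fderiv_apply_self {y : V} (hy : y ≠ 0) : fderiv ℝ E y y = 2 * E y := by
  simpa using hE.homogeneous.fderiv_apply_self hy (hE.smooth.differentiableAt hy)

theorem pos {y : V} (hy : y ≠ 0) : 0 < E y := by
  have h := hE.posDef y hy y hy
  rw [hE.hess_apply_self hy, hE.fderiv_apply_self hy] at h
  linarith

theorem smoothOff_inv_sqrt : SmoothOff fun y => (√(2 * E y))⁻¹ := fun y hy => by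
  have hEy := hE.pos hy
  exact ((contDiffAt_const.mul (hE.smooth y hy)).sqrt (by positivity)).inv (by positivity)

theorem isPosHomogeneous_sqrt : IsPosHomogeneous 1 fun y => √(2 * E y) := fun y hy t ht => by
  simp only [hE.homogeneous y hy t ht, smul_eq_mul, pow_one]
  rw [mul_left_comm, Real.sqrt_mul (by positivity), Real.sqrt_sq ht.le]

theorem lieDeriv_inv_sqrt_eq_zero {B : V →L[ℝ] V} {y : V} (hy : y ≠ 0)
    (hlie : lieDeriv B E y = 0) : lieDeriv B (fun z => (√(2 * E z))⁻¹) y = 0 := by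
  have hEy := hE.pos hy
  have hsqrt := ((hE.smooth.differentiableAt hy).hasFDerivAt.const_mul 2).sqrt (by positivity)
  have hinv := (hasDerivAt_inv (by positivity)).comp_hasFDerivAt y hsqrt
  have hderiv := congrArg (· (B y)) hinv.fderiv
  simp only [smul_apply] at hderiv
  rw [lieDeriv] at hlie ⊢
  exact hderiv.trans (by rw [hlie, smul_zero, smul_zero, smul_zero])

theorem exists_eq_mul_forall_le_mul [FiniteDimensional ℝ V] [Nontrivial V] {f : V → ℝ}
    (hf : SmoothOff f) (hhom : IsPosHomogeneous 2 f) :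
    ∃ (m : ℝ) (z : V), z ≠ 0 ∧ f z = m * E z ∧ ∀ w, w ≠ 0 → f w ≤ m * E w := by
  obtain ⟨z, hz, hmax⟩ := (hhom.div hE.homogeneous).exists_forall_le fun w hw =>
    ((hf w hw).continuousAt.div (hE.smooth w hw).continuousAt
      (hE.pos hw).ne').continuousWithinAt
  exact ⟨f z / E z, z, hz, (div_mul_cancel₀ _ (hE.pos hz).ne').symm,
    fun w hw => (div_le_iff₀ (hE.pos hw)).1 (hmax w hw)⟩

theorem hess_injective {y : V} (hy : y ≠ 0) : Function.Injective (fderiv ℝ (fderiv ℝ E) y) := by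
  refine (injective_iff_map_eq_zero _).2 fun v hv => ?_
  by_contra hne
  simpa [hv] using hE.posDef y hy v hne

theorem comp_equiv {W : Type*} [NormedAddCommGroup W] [NormedSpace ℝ W] (T : W ≃L[ℝ] V) :
    IsMinkowskiEnergy (E ∘ T) where
  smooth := hE.smooth.comp_equiv T
  homogeneous w hw t ht := by simp [hE.homogeneous _ ((map_ne_zero_iff T T.injective).2 hw) t ht]
  posDef w hw v hv := by
    rw [hE.smooth.fderiv_fderiv_comp_equiv T hw]
    exact hE.posDef _ ((map_ne_zero_iff T T.injective).2 hw) _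
      ((map_ne_zero_iff T T.injective).2 hv)

end IsMinkowskiEnergy

namespace IsGradient

variable {E : V → ℝ} {a : V →L[ℝ] ℝ} {X : V → V} (hX : IsGradient E a X)
  (hE : IsMinkowskiEnergy E)
include hX hE

theorem hess_fderiv_apply {y : V} (hy : y ≠ 0) (u : V) :
    fderiv ℝ (fderiv ℝ E) y (fderiv ℝ X y u) = -fderiv ℝ (fderiv ℝ (fderiv ℝ E)) y u (X y) := by
  have h := hE.smooth.fderiv_right.fderiv_right.fderiv_clm_apply hX.smooth hy u
  rw [fderiv_congr_off_zero hX.hess_apply hy, fderiv_fun_const, Pi.zero_apply, zero_apply] at h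
  exact (neg_eq_of_add_eq_zero_right h.symm).symm

theorem apply_fderiv_apply {y : V} (hy : y ≠ 0) (u : V) :
    a (fderiv ℝ X y u) = -fderiv ℝ (fderiv ℝ (fderiv ℝ E)) y u (X y) (X y) := by
  rw [← neg_apply, ← hX.hess_fderiv_apply hE hy, ← hX.hess_apply y hy,
    hE.smooth.fderiv_fderiv_comm hy]

theorem fderiv_energy {y : V} (hy : y ≠ 0) : fderiv ℝ E y (X y) = a y := by
  rw [← hE.hess_apply_self hy, hE.smooth.fderiv_fderiv_comm hy, hX.hess_apply y hy]

omit hE in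
theorem ne_zero (ha : a ≠ 0) {y : V} (hy : y ≠ 0) : X y ≠ 0 := fun h => by
  simp [← hX.hess_apply y hy, h] at ha

theorem apply_pos (ha : a ≠ 0) {y : V} (hy : y ≠ 0) : 0 < a (X y) := by
  have h := hE.posDef y hy (X y) (hX.ne_zero ha hy)
  rwa [hX.hess_apply y hy] at h

theorem isPosHomogeneous : IsPosHomogeneous 0 X := fun y hy t ht => by
  have hhess := (hE.homogeneous.fderiv_right hE.smooth).fderiv_right hE.smooth.fderiv_right
    y hy t ht
  rw [pow_zero, one_smul] at hhess ⊢
  refine hE.hess_injective hy ?_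
  rw [← hhess, hX.hess_apply _ (smul_ne_zero ht.ne' hy), hhess, hX.hess_apply y hy]

theorem exists_isPolarization_mul_apply (hV : 1 < Module.finrank ℝ V)
    (hthird : ∀ y, y ≠ 0 →
      fderiv ℝ (fderiv ℝ (fderiv ℝ fun z => a z * a z - E z * a (X z))) y = 0) :
    ∃ q, IsPolarization q fun y => E y * a (X y) := by
  have ha := SmoothOff.of_clm a
  have hdiff : SmoothOff fun y => a y * a y - E y * a (X y) :=
    (ha.mul ha).sub (hE.smooth.mul ((SmoothOff.const a).clm_apply hX.smooth))
  have hhom : IsPosHomogeneous 2 fun y => a y * a y - E y * a (X y) := fun y hy t ht => by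
    simp only [hE.homogeneous y hy t ht, hX.isPosHomogeneous hE y hy t ht, map_smul, smul_eq_mul]
    ring
  obtain ⟨r, hr⟩ := exists_isPolarization_of_fderiv_fderiv_fderiv_eq_zero hV hdiff hhom hthird
  refine ⟨a.smulRight a - r, fun u v => by simp [hr.symm u v, mul_comm], fun y hy => ?_⟩
  simp [← hr.eq_apply_self y hy]

/-- `2 E` and `a(X)` are the square lengths of `y` and `X`, and `a y` is their scalar product, so
this is the equality case of the Cauchy–Schwarz inequality. -/
theorem eq_smul_of_two_mul_le {y : V} (hy : y ≠ 0) (hle : 2 * E y * a (X y) ≤ a y ^ 2) :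
    X y = (a y / (2 * E y)) • y := by
  by_contra hne
  have hpos := hE.posDef y hy _ (sub_ne_zero.2 hne)
  have hEy := hE.pos hy
  have hnorm : fderiv ℝ (fderiv ℝ E) y (X y - (a y / (2 * E y)) • y)
      (X y - (a y / (2 * E y)) • y) = a (X y) - a y ^ 2 / (2 * E y) := by
    simp only [map_sub, map_smul, sub_apply, smul_apply, smul_eq_mul, hX.hess_apply y hy,
      hE.hess_apply_self hy, hX.fderiv_energy hE hy, hE.fderiv_apply_self hy]
    field_simp
    ring
  rw [hnorm, sub_pos, div_lt_iff₀ (by positivity)] at hpos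
  linarith

end IsGradient

namespace IsMinkowskiEnergy

variable {E : V → ℝ} (hE : IsMinkowskiEnergy E) {a : V →L[ℝ] ℝ} {X : V → V}
  (hX : IsGradient E a X) {q : V →L[ℝ] V →L[ℝ] ℝ}
  (hq : IsPolarization q fun y => E y * a (X y)) {B : V →L[ℝ] V}
  (hB : IsInfinitesimalIsometry q a B)
include hE hX hq

theorem fderiv_mul_add_mul_fderiv {y : V} (hy : y ≠ 0) (u : V) :
    fderiv ℝ E y u * a (X y) + E y * a (fderiv ℝ X y u) = 2 * q y u := by
  have haX := (SmoothOff.const a).fderiv_clm_apply hX.smooth hy u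
  rw [fderiv_fun_const, Pi.zero_apply, zero_apply, zero_apply, zero_add] at haX
  rw [← hq.fderiv_apply hy, ← haX, fderiv_fun_mul (hE.smooth.differentiableAt hy)
    (((SmoothOff.const a).clm_apply hX.smooth).differentiableAt hy)]
  simp only [add_apply, smul_apply, smul_eq_mul]
  ring

theorem pos_of_isPolarization (ha : a ≠ 0) {y : V} (hy : y ≠ 0) : 0 < q y y := by
  rw [← hq.eq_apply_self y hy]
  exact mul_pos (hE.pos hy) (hX.apply_pos hE ha hy)

include hB

theorem mul_hess_lieDeriv {y : V} (hy : y ≠ 0) :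
    E y * fderiv ℝ (fderiv ℝ (lieDeriv B E)) y (X y) (X y) = lieDeriv B E y * a (X y) := by
  have hthird : fderiv ℝ (fderiv ℝ (fderiv ℝ E)) y (X y) (X y) (B y)
      = -a (fderiv ℝ X y (B y)) := by
    rw [hX.apply_fderiv_apply hE hy, neg_neg, hE.smooth.fderiv_fderiv_fderiv_comm hy,
      hE.smooth.fderiv_right.fderiv_fderiv_comm hy]
  have hrel := hE.fderiv_mul_add_mul_fderiv hX hq hy (B y)
  rw [hB.apply_self, mul_zero] at hrel
  rw [fderiv_fderiv_lieDeriv B hE.smooth hy, hthird, hX.hess_apply y hy, hB.map_apply, lieDeriv]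
  linear_combination -hrel

theorem two_mul_le_of_isMax (ha : a ≠ 0) {ε m : ℝ} (hε : 0 < ε)
    (hle : ∀ z, z ≠ 0 → lieDeriv B E z + ε * a z ^ 2 ≤ m * E z) {y : V} (hy : y ≠ 0)
    (heq : lieDeriv B E y + ε * a y ^ 2 = m * E y) : 2 * E y * a (X y) ≤ a y ^ 2 := by
  have hlie := hE.smooth.lieDeriv_right B
  have hsq : SmoothOff fun z => ε * a z ^ 2 := fun z _ => by fun_prop
  have hmE : SmoothOff fun z => -m * E z := (SmoothOff.const (-m)).mul hE.smooth
  have hpol : IsPolarization (ε • a.smulRight a) fun z => ε * a z ^ 2 :=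
    ⟨fun u v => by simp [mul_comm], fun z _ => by simp [sq]⟩
  have hmax : IsLocalMax (fun z => lieDeriv B E z + ε * a z ^ 2 + -m * E z) y := by
    filter_upwards [isOpen_ne.eventually_mem hy] with z hz
    linarith [hle z hz]
  have hhess := fderiv_fderiv_nonpos_of_isLocalMax
    ((((hlie.add hsq).add hmE) y hy).of_le (WithTop.coe_le_coe.2 le_top)) hmax (X y)
  rw [(hlie.add hsq).fderiv_fderiv_add hmE hy, hlie.fderiv_fderiv_add hsq hy,
    hE.smooth.fderiv_fderiv_const_mul (-m) hy] at hhess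
  simp only [add_apply, smul_apply, hpol.fderiv_fderiv_apply hy, hX.hess_apply y hy,
    ContinuousLinearMap.smulRight_apply, smul_eq_mul] at hhess
  have hEy := hE.pos hy
  have hfactor : ε * a (X y) * (2 * E y * a (X y) - a y ^ 2) ≤ 0 := by
    have := mul_nonpos_of_nonneg_of_nonpos hEy.le hhess
    linear_combination this - hE.mul_hess_lieDeriv hX hq hB hy - a (X y) * heq
  have haX := hX.apply_pos hE ha hy
  exact sub_nonpos.1 (nonpos_of_mul_nonpos_right hfactor (by positivity))

theorem lieDeriv_eq_zero_of_isMax (ha : a ≠ 0) {ε m : ℝ} (hε : 0 < ε)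
    (hle : ∀ z, z ≠ 0 → lieDeriv B E z + ε * a z ^ 2 ≤ m * E z) {y : V} (hy : y ≠ 0)
    (heq : lieDeriv B E y + ε * a y ^ 2 = m * E y) : lieDeriv B E y = 0 := by
  have hradial := hX.eq_smul_of_two_mul_le hE hy
    (hE.two_mul_le_of_isMax hX hq hB ha hε hle hy heq)
  have hcoeff : a y / (2 * E y) ≠ 0 := fun h => hX.ne_zero ha hy (by rw [hradial, h, zero_smul])
  have happly : a y / (2 * E y) * lieDeriv B E y = 0 := by
    rw [lieDeriv, ← hE.hess_apply_self hy, ← smul_eq_mul, ← smul_apply, ← map_smul, ← hradial,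
      hX.hess_apply y hy, hB.map_apply]
  exact (mul_eq_zero.1 happly).resolve_left hcoeff

theorem lieDeriv_nonpos [FiniteDimensional ℝ V] (ha : a ≠ 0) {y : V} (hy : y ≠ 0) :
    lieDeriv B E y ≤ 0 := by
  have : Nontrivial V := ⟨y, 0, hy⟩
  have hlie := hE.smooth.lieDeriv_right B
  have hlieHom : IsPosHomogeneous 2 (lieDeriv B E) := hE.homogeneous.lieDeriv_right B hE.smooth
  have hsq (c : ℝ) : SmoothOff fun z => c * a z ^ 2 := fun z _ => by fun_prop
  have hsqHom (c : ℝ) : IsPosHomogeneous 2 fun z => c * a z ^ 2 := fun z _ t _ => by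
    simp only [map_smul, smul_eq_mul]
    ring
  obtain ⟨M, -, -, -, hM⟩ := hE.exists_eq_mul_forall_le_mul (hsq 1) (hsqHom 1)
  have hbound (ε : ℝ) (hε : 0 < ε) : lieDeriv B E y ≤ ε * (M * E y) := by
    obtain ⟨m, z, hz, heq, hm⟩ :=
      hE.exists_eq_mul_forall_le_mul (hlie.add (hsq ε)) (hlieHom.add (hsqHom ε))
    rw [hE.lieDeriv_eq_zero_of_isMax hX hq hB ha hε hm hz heq, zero_add] at heq
    have hmM : m ≤ ε * M := by
      refine le_of_mul_le_mul_right ?_ (hE.pos hz)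
      rw [← heq, mul_assoc]
      gcongr
      linarith [hM z hz]
    calc lieDeriv B E y ≤ lieDeriv B E y + ε * a y ^ 2 := by
          linarith [mul_nonneg hε.le (sq_nonneg (a y))]
      _ ≤ m * E y := hm y hy
      _ ≤ ε * M * E y := mul_le_mul_of_nonneg_right hmM (hE.pos hy).le
      _ = ε * (M * E y) := mul_assoc _ _ _
  have hlim : Filter.Tendsto (fun ε : ℝ => ε * (M * E y)) (nhdsWithin 0 (Set.Ioi 0)) (nhds 0) := by
    have hcont : Continuous fun ε : ℝ => ε * (M * E y) := by fun_prop
    exact (hcont.tendsto' 0 0 (zero_mul _)).mono_left nhdsWithin_le_nhds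
  exact ge_of_tendsto hlim (eventually_mem_nhdsWithin.mono hbound)

theorem lieDeriv_eq_zero [FiniteDimensional ℝ V] (ha : a ≠ 0) {y : V} (hy : y ≠ 0) :
    lieDeriv B E y = 0 := by
  refine le_antisymm (hE.lieDeriv_nonpos hX hq hB ha hy) ?_
  simpa [lieDeriv] using hE.lieDeriv_nonpos hX hq hB.neg ha hy

theorem lieDeriv_gradient [FiniteDimensional ℝ V] (ha : a ≠ 0) {y : V} (hy : y ≠ 0) :
    lieDeriv B X y = B (X y) := by
  refine hE.hess_injective hy (ContinuousLinearMap.ext fun w => ?_)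
  have hzero {z : V} (hz : z ≠ 0) : fderiv ℝ (lieDeriv B E) z = 0 := by
    rw [fderiv_congr_off_zero (fun z hz => hE.lieDeriv_eq_zero hX hq hB ha hz) hz]
    simp
  have hzero₂ : fderiv ℝ (fderiv ℝ (lieDeriv B E)) y = 0 := by
    rw [fderiv_congr_off_zero (fun z hz => hzero hz) hy]
    simp
  have hexpand := fderiv_fderiv_lieDeriv B hE.smooth hy w (X y)
  rw [hzero₂, zero_apply, zero_apply, hX.hess_apply y hy, hB.map_apply, add_zero] at hexpand
  have hthird : fderiv ℝ (fderiv ℝ (fderiv ℝ E)) y (B y) (X y) w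
      = fderiv ℝ (fderiv ℝ (fderiv ℝ E)) y w (X y) (B y) := by
    rw [hE.smooth.fderiv_right.fderiv_fderiv_comm hy, hE.smooth.fderiv_fderiv_fderiv_comm hy,
      hE.smooth.fderiv_right.fderiv_fderiv_comm hy]
  rw [lieDeriv, hX.hess_fderiv_apply hE hy, neg_apply, hthird,
    hE.smooth.fderiv_fderiv_comm hy (B (X y))]
  linarith

omit hB in
theorem exists_gradient_sq_eq (hV : 3 ≤ Module.finrank ℝ V) (ha : a ≠ 0) :
    ∃ c : ℝ, ∀ y, y ≠ 0 → a y = 0 → a (X y) = c := by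
  have : FiniteDimensional ℝ V := .of_finrank_pos (by lia)
  have hhom : IsPosHomogeneous 0 fun y => a (X y) := fun y hy t ht => by
    simp [hX.isPosHomogeneous hE y hy t ht]
  refine exists_eq_on_ker_of_lieDeriv_eq_zero hV hq.symm
    (fun y hy => hE.pos_of_isPolarization hX hq ha hy) ((SmoothOff.const a).clm_apply hX.smooth)
    hhom fun B hB y hy _ => ?_
  have hequi := hE.lieDeriv_gradient hX hq hB ha hy
  rw [lieDeriv] at hequi
  rw [lieDeriv, (SmoothOff.const a).fderiv_clm_apply hX.smooth hy, hequi, hB.map_apply]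
  simp

theorem lieDeriv_apply_gradient_eq_zero [FiniteDimensional ℝ V] (ha : a ≠ 0) {y : V}
    (hy : y ≠ 0) : lieDeriv B (fun z => q z (X z)) y = 0 := by
  have hequi := hE.lieDeriv_gradient hX hq hB ha hy
  rw [lieDeriv] at hequi
  rw [lieDeriv, (SmoothOff.of_clm q).fderiv_clm_apply hX.smooth hy, hequi, q.fderiv,
    hq.symm (B y), add_comm, hB.apply_add_apply]

omit hB

theorem sqrt_mul_gradient_fderiv {y : V} (hy : y ≠ 0) (hay : a y = 0) :
    √(2 * E y) * a (fderiv ℝ X y (X y)) = 4 * (q y (X y) * (√(2 * E y))⁻¹) := by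
  have hEy := hE.pos hy
  have hrel := hE.fderiv_mul_add_mul_fderiv hX hq hy (X y)
  rw [hX.fderiv_energy hE hy, hay, zero_mul, zero_add] at hrel
  have hsq : √(2 * E y) ^ 2 = 2 * E y := Real.sq_sqrt (by positivity)
  field_simp
  rw [hsq]
  linarith

theorem exists_sqrt_mul_gradient_fderiv_eq (hV : 3 ≤ Module.finrank ℝ V) (ha : a ≠ 0) :
    ∃ c : ℝ, ∀ y, y ≠ 0 → a y = 0 → √(2 * E y) * a (fderiv ℝ X y (X y)) = c := by
  have : FiniteDimensional ℝ V := .of_finrank_pos (by lia)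
  have hqX : SmoothOff fun y => q y (X y) := (SmoothOff.of_clm q).clm_apply hX.smooth
  have hqXHom : IsPosHomogeneous 1 fun y => q y (X y) := fun y hy t ht => by
    simp [hX.isPosHomogeneous hE y hy t ht]
  obtain ⟨c, hc⟩ := exists_eq_on_ker_of_lieDeriv_eq_zero hV (a := a) hq.symm
    (fun y hy => hE.pos_of_isPolarization hX hq ha hy) (hqX.mul hE.smoothOff_inv_sqrt)
    (by simpa only [div_eq_mul_inv] using hqXHom.div hE.isPosHomogeneous_sqrt)
    fun B hB y hy _ => by
      have hqX₀ := hE.lieDeriv_apply_gradient_eq_zero hX hq hB ha hy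
      have hsqrt₀ := hE.lieDeriv_inv_sqrt_eq_zero hy (hE.lieDeriv_eq_zero hX hq hB ha hy)
      rw [lieDeriv] at hqX₀ hsqrt₀ ⊢
      rw [fderiv_fun_mul (hqX.differentiableAt hy) (hE.smoothOff_inv_sqrt.differentiableAt hy)]
      simp only [add_apply, smul_apply, hqX₀, hsqrt₀, smul_zero, add_zero]
  exact ⟨4 * c, fun y hy hay => by rw [hE.sqrt_mul_gradient_fderiv hX hq hy hay, hc y hy hay]⟩

end IsMinkowskiEnergy

end Minkowski

section Spray

variable {V : Type*} [NormedAddCommGroup V] [NormedSpace ℝ V]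

/-- The isomorphism from covectors to vectors given by the Hessian metric of `E` at `y`, that is,
the matrix `(gˡᵐ)`; it is `0` where the Hessian is degenerate. -/
noncomputable def sharp (E : V → ℝ) (y : V) : (V →L[ℝ] ℝ) →L[ℝ] V :=
  (fderiv ℝ (fderiv ℝ E) y).inverse

namespace IsMinkowskiEnergy

variable {E : V → ℝ} (hE : IsMinkowskiEnergy E)
include hE

theorem const_mul {c : ℝ} (hc : 0 < c) : IsMinkowskiEnergy fun y => c * E y where
  smooth := (SmoothOff.const c).mul hE.smooth
  homogeneous y hy t ht := by
    simp only [hE.homogeneous y hy t ht, smul_eq_mul]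
    ring
  posDef y hy v hv := by
    rw [hE.smooth.fderiv_fderiv_const_mul c hy]
    exact mul_pos hc (hE.posDef y hy v hv)

variable [FiniteDimensional ℝ V]

theorem hess_isInvertible {y : V} (hy : y ≠ 0) : (fderiv ℝ (fderiv ℝ E) y).IsInvertible := by
  have hdim : Module.finrank ℝ V = Module.finrank ℝ (V →L[ℝ] ℝ) :=
    Subspace.dual_finrank_eq.symm.trans LinearMap.toContinuousLinearMap.finrank_eq
  exact ⟨((fderiv ℝ (fderiv ℝ E) y).toLinearMap.linearEquivOfInjective
    (hE.hess_injective hy) hdim).toContinuousLinearEquiv, rfl⟩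

theorem hess_sharp {y : V} (hy : y ≠ 0) (A : V →L[ℝ] ℝ) :
    fderiv ℝ (fderiv ℝ E) y (sharp E y A) = A :=
  (hE.hess_isInvertible hy).self_apply_inverse A

theorem sharp_fderiv {y : V} (hy : y ≠ 0) : sharp E y (fderiv ℝ E y) = y := by
  rw [← hE.hess_apply_self hy]
  exact (hE.hess_isInvertible hy).inverse_apply_self y

theorem smoothOff_sharp : SmoothOff (sharp E) := fun y hy => by
  have := FiniteDimensional.complete ℝ V
  exact (hE.hess_isInvertible hy).contDiffAt_map_inverse.comp y
    (hE.smooth.fderiv_right.fderiv_right y hy)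

theorem isGradient_sharp (a : V →L[ℝ] ℝ) : IsGradient E a fun y => sharp E y a where
  smooth := hE.smoothOff_sharp.clm_apply (SmoothOff.const a)
  hess_apply _ hy := hE.hess_sharp hy a

theorem sharp_const_mul {c : ℝ} (hc : 0 < c) {y : V} (hy : y ≠ 0) (A : V →L[ℝ] ℝ) :
    sharp (fun z => c * E z) y A = c⁻¹ • sharp E y A := by
  refine (hE.const_mul hc).hess_injective hy ?_
  rw [(hE.const_mul hc).hess_sharp hy]
  rw [hE.smooth.fderiv_fderiv_const_mul c hy, smul_apply, map_smul, hE.hess_sharp hy,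
    smul_inv_smul₀ hc.ne']

end IsMinkowskiEnergy

/-- The partial differential `∂e/∂x` of a function `e (x, y)`. -/
noncomputable def horizontalDeriv (e : V → V → ℝ) (x y : V) : V →L[ℝ] ℝ :=
  fderiv ℝ (fun x' => e x' y) x

/-- The covector `yᵏ ∂²e/∂yᵐ∂xᵏ - ∂e/∂xᵐ` of the Euler–Lagrange equations of `e`. -/
noncomputable def eulerLagrange (e : V → V → ℝ) (x y : V) : V →L[ℝ] ℝ :=
  (fderiv ℝ (horizontalDeriv e x) y).flip y - horizontalDeriv e x y

/-- The vector `(Gˡ)` of the geodesic spray coefficients of the energy `e`. -/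
noncomputable def geodesicSpray (e : V → V → ℝ) (x y : V) : V :=
  (1 / 2 : ℝ) • sharp (e x) y (eulerLagrange e x y)

/-- `e` has the properties of the energy of a Finsler metric in coordinates, as far as they concern
its first order Taylor expansion at `x`, on which the spray coefficients depend. -/
structure IsFinslerEnergyAt (e : V → V → ℝ) (x : V) : Prop where
  differentiableAt : ∀ y, y ≠ 0 → DifferentiableAt ℝ (fun x' => e x' y) x
  smooth_horizontalDeriv : SmoothOff (horizontalDeriv e x)
  isMinkowskiEnergy : IsMinkowskiEnergy (e x)

namespace IsFinslerEnergyAt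

variable {e : V → V → ℝ} {x : V}

theorem of_contDiffAt (he : ∀ y, y ≠ 0 → ContDiffAt ℝ ∞ (Function.uncurry e) (x, y))
    (hE : IsMinkowskiEnergy (e x)) : IsFinslerEnergyAt e x where
  differentiableAt y hy := ((he y hy).comp (f := fun x' => (x', y)) x
    (contDiffAt_id.prodMk contDiffAt_const)).differentiableAt (by simp)
  smooth_horizontalDeriv y hy := by
    have hswap : ContDiffAt ℝ ∞ (Function.uncurry fun y x => e x y) (y, x) :=
      (he y hy).comp (f := Prod.swap) (y, x) (contDiffAt_snd.prodMk contDiffAt_fst)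
    exact ContDiffAt.fderiv (g := fun _ => x) hswap contDiffAt_const (by simp)
  isMinkowskiEnergy := hE

variable (h : IsFinslerEnergyAt e x)
include h

theorem smoothOff_geodesicSpray [FiniteDimensional ℝ V] : SmoothOff (geodesicSpray e x) :=
  fun y hy => by
  have hflip := (ContinuousLinearMap.apply ℝ ℝ).contDiff.contDiffAt.clm_comp
    (h.smooth_horizontalDeriv.fderiv_right y hy)
  exact contDiffAt_const.smul ((h.isMinkowskiEnergy.smoothOff_sharp y hy).clm_apply
    (hflip.sub (h.smooth_horizontalDeriv y hy)))

theorem horizontalDeriv_conformal {β : V → ℝ} (hβ : DifferentiableAt ℝ β x) {y : V} (hy : y ≠ 0) :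
    horizontalDeriv (fun x y => Real.exp (2 * β x) * e x y) x y
      = Real.exp (2 * β x) • (horizontalDeriv e x y + (2 * e x y) • fderiv ℝ β x) := by
  have hproduct := ((hβ.hasFDerivAt.const_mul 2).exp).mul (h.differentiableAt y hy).hasFDerivAt
  ext v
  refine (congrArg (· v) hproduct.fderiv).trans ?_
  simp only [add_apply, smul_apply, smul_eq_mul, horizontalDeriv]
  ring

theorem conformal {β : V → ℝ} (hβ : DifferentiableAt ℝ β x) :
    IsFinslerEnergyAt (fun x y => Real.exp (2 * β x) * e x y) x where
  differentiableAt y hy := (hβ.const_mul 2).exp.mul (h.differentiableAt y hy)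
  smooth_horizontalDeriv y hy := by
    have henergy := h.isMinkowskiEnergy.smooth y hy
    have hsmooth := (contDiffAt_const (c := Real.exp (2 * β x))).smul
      ((h.smooth_horizontalDeriv y hy).add
        ((henergy.const_smul (2 : ℝ)).smul (contDiffAt_const (c := fderiv ℝ β x))))
    exact hsmooth.congr_of_eventuallyEq
      (eventuallyEq_of_eq_off_zero (fun z hz => h.horizontalDeriv_conformal hβ hz) hy)
  isMinkowskiEnergy := h.isMinkowskiEnergy.const_mul (Real.exp_pos _)

theorem eulerLagrange_conformal {β : V → ℝ} (hβ : DifferentiableAt ℝ β x) {y : V} (hy : y ≠ 0) :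
    eulerLagrange (fun x y => Real.exp (2 * β x) * e x y) x y
      = Real.exp (2 * β x) • (eulerLagrange e x y + (2 * fderiv ℝ β x y) • fderiv ℝ (e x) y
        - (2 * e x y) • fderiv ℝ β x) := by
  have hvertical := (((h.smooth_horizontalDeriv.differentiableAt hy).hasFDerivAt.add
    (((h.isMinkowskiEnergy.smooth.differentiableAt hy).hasFDerivAt.const_mul 2).smul_const
      (fderiv ℝ β x))).const_smul (Real.exp (2 * β x))).fderiv
  rw [eulerLagrange, eulerLagrange, h.horizontalDeriv_conformal hβ hy,
    fderiv_congr_off_zero (fun z hz => h.horizontalDeriv_conformal hβ hz) hy]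
  ext v
  have hv := congrArg (· v y) hvertical
  simp only [smul_apply, add_apply, ContinuousLinearMap.smulRight_apply, smul_eq_mul] at hv
  simp only [sub_apply, smul_apply, add_apply, ContinuousLinearMap.flip_apply, smul_eq_mul]
  refine (congrArg (· - _) hv).trans ?_
  ring

theorem geodesicSpray_conformal [FiniteDimensional ℝ V] {β : V → ℝ} (hβ : DifferentiableAt ℝ β x)
    {y : V} (hy : y ≠ 0) :
    geodesicSpray (fun x y => Real.exp (2 * β x) * e x y) x y
      = geodesicSpray e x y
        + (fderiv ℝ β x y • y - e x y • sharp (e x) y (fderiv ℝ β x)) := by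
  have hexp := Real.exp_pos (2 * β x)
  rw [geodesicSpray, geodesicSpray, h.isMinkowskiEnergy.sharp_const_mul hexp hy,
    h.eulerLagrange_conformal hβ hy, map_smul, inv_smul_smul₀ hexp.ne', map_sub, map_add,
    map_smul, map_smul, h.isMinkowskiEnergy.sharp_fderiv hy]
  module

theorem exists_isPolarization_of_apply_fderiv_geodesicSpray_eq [FiniteDimensional ℝ V]
    (hV : 1 < Module.finrank ℝ V) {β : V → ℝ} (hβ : DifferentiableAt ℝ β x)
    (hspray : ∀ y, y ≠ 0 →
      fderiv ℝ (fderiv ℝ (fderiv ℝ fun z => fderiv ℝ β x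
          (geodesicSpray (fun x y => Real.exp (2 * β x) * e x y) x z))) y
        = fderiv ℝ (fderiv ℝ (fderiv ℝ fun z => fderiv ℝ β x (geodesicSpray e x z))) y) :
    ∃ q, IsPolarization q fun y => e x y * fderiv ℝ β x (sharp (e x) y (fderiv ℝ β x)) := by
  set a := fderiv ℝ β x
  have hE := h.isMinkowskiEnergy
  have hX := hE.isGradient_sharp a
  have ha := SmoothOff.of_clm a
  refine hX.exists_isPolarization_mul_apply hE hV fun y hy => ?_
  have hG : SmoothOff fun z => a (geodesicSpray e x z) :=
    (SmoothOff.const a).clm_apply h.smoothOff_geodesicSpray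
  have hdiff : SmoothOff fun z => a z * a z - e x z * a (sharp (e x) z a) :=
    (ha.mul ha).sub (hE.smooth.mul ((SmoothOff.const a).clm_apply hX.smooth))
  have hsplit (z : V) (hz : z ≠ 0) :
      a (geodesicSpray (fun x y => Real.exp (2 * β x) * e x y) x z)
        = a (geodesicSpray e x z) + (a z * a z - e x z * a (sharp (e x) z a)) := by
    simp only [h.geodesicSpray_conformal hβ hz, map_add, map_sub, map_smul, smul_eq_mul, a]
  have heq := hspray y hy
  rw [fderiv_congr_off_zero (fun z hz => fderiv_congr_off_zero
    (fun z hz => fderiv_congr_off_zero hsplit hz) hz) hy,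
    hG.fderiv_fderiv_fderiv_add hdiff hy] at heq
  ext u v w
  simpa using congrArg (· u v w) heq

end IsFinslerEnergyAt

end Spray

section Coordinates

open scoped Matrix

variable {n : ℕ}

/-- The components `(aₗ)` of a covector. -/
noncomputable def comps (a : Coord n →L[ℝ] ℝ) (l : Fin n) : ℝ :=
  a (EuclideanSpace.single l 1)

theorem comps_dotProduct (a : Coord n →L[ℝ] ℝ) (y : Coord n) : comps a ⬝ᵥ y.ofLp = a y := by
  have hsum := (EuclideanSpace.basisFun (Fin n) ℝ).sum_repr y
  conv_rhs => rw [← hsum]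
  simp [dotProduct, comps, mul_comm]

theorem ext_single {W : Type*} [NormedAddCommGroup W] [NormedSpace ℝ W] {A B : Coord n →L[ℝ] W}
    (h : ∀ i, A (EuclideanSpace.single i 1) = B (EuclideanSpace.single i 1)) : A = B :=
  ContinuousLinearMap.coe_injective
    ((EuclideanSpace.basisFun (Fin n) ℝ).toBasis.ext fun i => by simpa using h i)

theorem comps_injective : Function.Injective (comps (n := n)) := fun _ _ hab =>
  ext_single (congrFun hab)

namespace SmoothOff

variable {f : Coord n → ℝ} (hf : SmoothOff f)
include hf

theorem pd_pd {y : Coord n} (hy : y ≠ 0) (i j : Fin n) :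
    pd (pd f i) j y
      = fderiv ℝ (fderiv ℝ f) y (EuclideanSpace.single j 1) (EuclideanSpace.single i 1) :=
  hf.fderiv_right.fderiv_clm_apply_const hy _ _

theorem pd_pd_pd {y : Coord n} (hy : y ≠ 0) (i j k : Fin n) :
    pd (pd (pd f i) j) k y = fderiv ℝ (fderiv ℝ (fderiv ℝ f)) y (EuclideanSpace.single k 1)
      (EuclideanSpace.single j 1) (EuclideanSpace.single i 1) := by
  have hD := hf.fderiv_right.fderiv_right
  rw [pd, fderiv_congr_off_zero (fun z hz => hf.pd_pd hz i j) hy,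
    (hD.clm_apply (const _)).fderiv_clm_apply_const hy, hD.fderiv_clm_apply_const hy]

end SmoothOff

section Vertical

variable {L : Coord n → ℝ}

theorem gMatrix_mulVec (hL : SmoothOff (energy L)) {y : Coord n} (hy : y ≠ 0) (u : Coord n) :
    gMatrix L y *ᵥ u.ofLp = comps (fderiv ℝ (fderiv ℝ (energy L)) y u) := by
  ext i
  refine Eq.trans ?_
    (comps_dotProduct ((fderiv ℝ (fderiv ℝ (energy L)) y).flip (EuclideanSpace.single i 1)) u)
  exact congrArg (· ⬝ᵥ u.ofLp) (funext fun j => hL.pd_pd hy i j)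

theorem isMinkowskiEnergy_energy (hL : SmoothOff (energy L))
    (hhom : ∀ y (t : ℝ), 0 < t → L (t • y) = t * L y) (hpos : ∀ y, y ≠ 0 → (gMatrix L y).PosDef) :
    IsMinkowskiEnergy (energy L) where
  smooth := hL
  homogeneous y _ t ht := by
    simp only [energy, hhom y t ht, smul_eq_mul]
    ring
  posDef y hy v hv := by
    have hform := (hpos y hy).dotProduct_mulVec_pos (x := v.ofLp) (by simpa using hv)
    rwa [star_trivial, gMatrix_mulVec hL hy, dotProduct_comm, comps_dotProduct] at hform

variable (hE : IsMinkowskiEnergy (energy L)) {y : Coord n} (hy : y ≠ 0)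
include hE hy

theorem isUnit_gMatrix : IsUnit (gMatrix L y) := by
  refine Matrix.mulVec_injective_iff_isUnit.1 fun u v huv => ?_
  have hcomps : gMatrix L y *ᵥ (WithLp.toLp 2 u).ofLp = gMatrix L y *ᵥ (WithLp.toLp 2 v).ofLp := huv
  rw [gMatrix_mulVec hE.smooth hy, gMatrix_mulVec hE.smooth hy] at hcomps
  exact WithLp.toLp_injective 2 (hE.hess_injective hy (comps_injective hcomps))

theorem inv_gMatrix_mulVec_comps (a : Coord n →L[ℝ] ℝ) :
    (gMatrix L y)⁻¹ *ᵥ comps a = (sharp (energy L) y a).ofLp := by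
  have hdet := (Matrix.isUnit_iff_isUnit_det _).1 (isUnit_gMatrix hE hy)
  have hsharp := gMatrix_mulVec hE.smooth hy (sharp (energy L) y a)
  rw [hE.hess_sharp hy] at hsharp
  rw [← hsharp, Matrix.mulVec_mulVec, Matrix.nonsing_inv_mul _ hdet, Matrix.one_mulVec]

theorem gradX_comps (a : Coord n →L[ℝ] ℝ) (l : Fin n) :
    gradX L (comps a) l y = sharp (energy L) y a l :=
  congrFun (inv_gMatrix_mulVec_comps hE hy a) l

theorem gradSq_comps (a : Coord n →L[ℝ] ℝ) :
    gradSq L (comps a) y = a (sharp (energy L) y a) := by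
  rw [← comps_dotProduct, dotProduct_comm]
  exact Finset.sum_congr rfl fun l _ => by rw [gradX_comps hE hy]

theorem pd_gradX_comps (a : Coord n →L[ℝ] ℝ) (l s : Fin n) :
    pd (gradX L (comps a) l) s y
      = fderiv ℝ (fun z => sharp (energy L) z a) y (EuclideanSpace.single s 1) l := by
  rw [pd, fderiv_congr_off_zero (fun z hz => gradX_comps hE hz a l) hy]
  exact congrArg (· (EuclideanSpace.single s 1))
    ((hE.isGradient_sharp a).smooth.fderiv_clm (EuclideanSpace.proj (𝕜 := ℝ) l) hy)

theorem gradDeriv_comps (a : Coord n →L[ℝ] ℝ) :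
    gradDeriv L (comps a) y
      = a (fderiv ℝ (fun z => sharp (energy L) z a) y (sharp (energy L) y a)) := by
  rw [← comps_dotProduct, dotProduct_comm]
  refine Finset.sum_congr rfl fun l _ => ?_
  rw [← Finset.sum_mul]
  congr 1
  refine Eq.trans ?_ (comps_dotProduct ((EuclideanSpace.proj (𝕜 := ℝ) l).comp
    (fderiv ℝ (fun z => sharp (energy L) z a) y)) (sharp (energy L) y a))
  exact Finset.sum_congr rfl fun s _ => by
    rw [pd_gradX_comps hE hy, gradX_comps hE hy]
    rfl

end Vertical

theorem exists_gradSq_comps_eq {L : Coord n → ℝ} (hn : 3 ≤ n) (hE : IsMinkowskiEnergy (energy L))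
    {a : Coord n →L[ℝ] ℝ} {q : Coord n →L[ℝ] Coord n →L[ℝ] ℝ}
    (hq : IsPolarization q fun y => energy L y * a (sharp (energy L) y a)) :
    ∃ c, ∀ y, y ≠ 0 → a y = 0 → gradSq L (comps a) y = c := by
  rcases eq_or_ne a 0 with rfl | ha
  · exact ⟨0, fun y hy _ => by rw [gradSq_comps hE hy, zero_apply]⟩
  obtain ⟨c, hc⟩ := hE.exists_gradient_sq_eq (hE.isGradient_sharp a) hq
    (by rwa [finrank_euclideanSpace_fin]) ha
  exact ⟨c, fun y hy hay => by rw [gradSq_comps hE hy, hc y hy hay]⟩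

theorem exists_mul_gradDeriv_comps_eq {L : Coord n → ℝ} (hn : 3 ≤ n)
    (hE : IsMinkowskiEnergy (energy L)) (hL : ∀ y, 0 ≤ L y) {a : Coord n →L[ℝ] ℝ}
    {q : Coord n →L[ℝ] Coord n →L[ℝ] ℝ}
    (hq : IsPolarization q fun y => energy L y * a (sharp (energy L) y a)) :
    ∃ c, ∀ y, y ≠ 0 → a y = 0 → L y * gradDeriv L (comps a) y = c := by
  rcases eq_or_ne a 0 with rfl | ha
  · exact ⟨0, fun y hy _ => by rw [gradDeriv_comps hE hy, zero_apply, mul_zero]⟩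
  obtain ⟨c, hc⟩ := hE.exists_sqrt_mul_gradient_fderiv_eq (hE.isGradient_sharp a) hq
    (by rwa [finrank_euclideanSpace_fin]) ha
  refine ⟨c, fun y hy hay => ?_⟩
  have hsq : 2 * energy L y = L y ^ 2 := by
    rw [energy]
    ring
  rw [gradDeriv_comps hE hy, ← hc y hy hay, hsq, Real.sqrt_sq (hL y)]

section Horizontal

variable {K : Coord n → Coord n → ℝ} {x : Coord n}

theorem spray_eq (h : IsFinslerEnergyAt (fun x => energy (K x)) x) {y : Coord n} (hy : y ≠ 0)
    (l : Fin n) : spray K l x y = geodesicSpray (fun x => energy (K x)) x y l := by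
  have hcomps : comps (eulerLagrange (fun x => energy (K x)) x y) = fun m =>
      (∑ k, y k * pd (fun y' => pd (fun x' => energy (K x') y') k x) m y)
        - pd (fun x' => energy (K x') y) m x := by
    ext m
    have hmixed := comps_dotProduct (fderiv ℝ (horizontalDeriv (fun x => energy (K x)) x) y
      (EuclideanSpace.single m 1)) y
    rw [comps, eulerLagrange, sub_apply, ContinuousLinearMap.flip_apply, ← hmixed, dotProduct_comm]
    congr 1
    refine Finset.sum_congr rfl fun k _ => congrArg (y k * ·) ?_
    exact (h.smooth_horizontalDeriv.fderiv_clm_apply_const hy _ _).symm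
  have hsharp := congrFun (inv_gMatrix_mulVec_comps h.isMinkowskiEnergy hy
    (eulerLagrange (fun x => energy (K x)) x y)) l
  rw [hcomps] at hsharp
  exact congrArg ((1 / 2) * ·) hsharp

theorem mixedCurvature_eq (h : IsFinslerEnergyAt (fun x => energy (K x)) x) {y : Coord n}
    (hy : y ≠ 0) (l i j k : Fin n) :
    mixedCurvature K l i j k x y
      = -fderiv ℝ (fderiv ℝ (fderiv ℝ (geodesicSpray (fun x => energy (K x)) x))) y
        (EuclideanSpace.single k 1) (EuclideanSpace.single j 1) (EuclideanSpace.single i 1) l := by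
  have hG := h.smoothOff_geodesicSpray
  have hspray : SmoothOff (spray K l x) := ((SmoothOff.const
    (EuclideanSpace.proj (𝕜 := ℝ) l)).clm_apply hG).congr fun z hz => spray_eq h hz l
  rw [mixedCurvature, hspray.pd_pd_pd hy, fderiv_congr_off_zero (fun z hz => fderiv_congr_off_zero
    (fun z hz => fderiv_congr_off_zero (fun z hz => spray_eq h hz l) hz) hz) hy]
  exact congrArg Neg.neg (hG.fderiv_fderiv_fderiv_clm (EuclideanSpace.proj (𝕜 := ℝ) l) hy _ _ _)

theorem sum_mixedCurvature_mul_comps (h : IsFinslerEnergyAt (fun x => energy (K x)) x)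
    {y : Coord n} (hy : y ≠ 0) (a : Coord n →L[ℝ] ℝ) (i j k : Fin n) :
    ∑ l, mixedCurvature K l i j k x y * comps a l
      = -fderiv ℝ (fderiv ℝ (fderiv ℝ fun z => a (geodesicSpray (fun x => energy (K x)) x z))) y
        (EuclideanSpace.single k 1) (EuclideanSpace.single j 1) (EuclideanSpace.single i 1) := by
  rw [h.smoothOff_geodesicSpray.fderiv_fderiv_fderiv_clm a hy, ← comps_dotProduct,
    dotProduct_comm, dotProduct, ← Finset.sum_neg_distrib]
  exact Finset.sum_congr rfl fun l _ => by rw [mixedCurvature_eq h hy, neg_mul]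

theorem energy_exp_mul (β : Coord n → ℝ) (K : Coord n → Coord n → ℝ) :
    (fun x => energy fun y => Real.exp (β x) * K x y)
      = fun x y => Real.exp (2 * β x) * energy (K x) y := by
  ext x y
  rw [energy, energy, two_mul, Real.exp_add]
  ring

theorem exists_isPolarization_of_sum_mixedCurvature_eq (hn : 1 < n)
    (h : IsFinslerEnergyAt (fun x => energy (K x)) x) {β : Coord n → ℝ}
    (hβ : DifferentiableAt ℝ β x)
    (hP : ∀ y, y ≠ 0 → ∀ i j k,
      ∑ l, mixedCurvature (fun x y => Real.exp (β x) * K x y) l i j k x y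
          * comps (fderiv ℝ β x) l
        = ∑ l, mixedCurvature K l i j k x y * comps (fderiv ℝ β x) l) :
    ∃ q, IsPolarization q fun y =>
      energy (K x) y * fderiv ℝ β x (sharp (energy (K x)) y (fderiv ℝ β x)) := by
  refine h.exists_isPolarization_of_apply_fderiv_geodesicSpray_eq
    (by rwa [finrank_euclideanSpace_fin]) hβ fun y hy => ?_
  have hconf := h.conformal hβ
  rw [← energy_exp_mul] at hconf ⊢
  refine ext_single fun k => ext_single fun j => ext_single fun i => ?_
  rw [← neg_inj, ← sum_mixedCurvature_mul_comps h hy, ← sum_mixedCurvature_mul_comps hconf hy]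
  exact hP y hy i j k

end Horizontal

end Coordinates

section Charts

variable {n : ℕ} {M : Type*} [TopologicalSpace M] [ChartedSpace (Coord n) M]
  {φ : OpenPartialHomeomorph M (Coord n)}

theorem mdifferentiable_of_mem_maximalAtlas (hφ : φ ∈ IsManifold.maximalAtlas (𝓡 n) ∞ M) :
    φ.MDifferentiable (𝓡 n) (𝓡 n) :=
  ⟨(contMDiffOn_of_mem_maximalAtlas hφ).mdifferentiableOn (by simp),
    (contMDiffOn_symm_of_mem_maximalAtlas hφ).mdifferentiableOn (by simp)⟩

/-- The derivative of the inverse of a chart, as a linear isomorphism of `ℝⁿ`. -/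
noncomputable def chartSymmDeriv (hφ : φ ∈ IsManifold.maximalAtlas (𝓡 n) ∞ M) {x : Coord n}
    (hx : x ∈ φ.target) : Coord n ≃L[ℝ] Coord n :=
  (mdifferentiable_of_mem_maximalAtlas hφ).symm.mfderiv hx

theorem differentiableAt_comp_symm (hφ : φ ∈ IsManifold.maximalAtlas (𝓡 n) ∞ M) {α : M → ℝ}
    {p : M} (hα : MDifferentiableAt (𝓡 n) 𝓘(ℝ, ℝ) α p) (hp : p ∈ φ.source) :
    DifferentiableAt ℝ (α ∘ φ.symm) (φ p) := by
  have hsymm := (mdifferentiable_of_mem_maximalAtlas hφ).mdifferentiableAt_symm (φ.map_source hp)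
  exact (MDifferentiableAt.comp (φ p) (by rwa [φ.left_inv hp]) hsymm).differentiableAt

theorem fderiv_comp_symm_vecCoords (hφ : φ ∈ IsManifold.maximalAtlas (𝓡 n) ∞ M) {α : M → ℝ}
    {p : M} (hα : MDifferentiableAt (𝓡 n) 𝓘(ℝ, ℝ) α p) (hp : p ∈ φ.source)
    (v : TangentSpace (𝓡 n) p) :
    fderiv ℝ (α ∘ φ.symm) (φ p) (vecCoords φ p v) = mfderiv (𝓡 n) 𝓘(ℝ, ℝ) α p v := by
  have hα' := (differentiableAt_comp_symm hφ hα hp).mdifferentiableAt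
  have hchart := (mdifferentiable_of_mem_maximalAtlas hφ).mdifferentiableAt hp
  have heq : α =ᶠ[nhds p] (α ∘ φ.symm) ∘ φ := by
    filter_upwards [φ.open_source.mem_nhds hp] with z hz
    simp only [Function.comp_apply, φ.left_inv hz]
  rw [heq.mfderiv_eq, mfderiv_comp p hα' hchart, mfderiv_eq_fderiv]
  rfl

theorem inCoords_vecCoords (hφ : φ ∈ IsManifold.maximalAtlas (𝓡 n) ∞ M)
    (F : TangentBundle (𝓡 n) M → ℝ) {p : M} (hp : p ∈ φ.source) (v : TangentSpace (𝓡 n) p) :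
    inCoords φ F (φ p) (vecCoords φ p v) = F ⟨p, v⟩ := by
  have hcongr (q : M) (w : Coord n) (hq : q = p) (hw : w = v) : F ⟨q, w⟩ = F ⟨p, v⟩ := by
    subst hq hw
    rfl
  exact hcongr _ _ (φ.left_inv hp)
    (DFunLike.congr_fun ((mdifferentiable_of_mem_maximalAtlas hφ).symm_comp_deriv hp) v)

variable [IsManifold (𝓡 n) ∞ M]

theorem inCoords_eq_fiber (hφ : φ ∈ IsManifold.maximalAtlas (𝓡 n) ∞ M)
    (F : TangentBundle (𝓡 n) M → ℝ) {x : Coord n} (hx : x ∈ φ.target) :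
    inCoords φ F x = fiber F (φ.symm x) ∘ chartSymmDeriv hφ hx :=
  rfl

theorem contMDiffOn_tangentMapWithin_symm (hφ : φ ∈ IsManifold.maximalAtlas (𝓡 n) ∞ M) :
    ContMDiffOn 𝓘(ℝ, Coord n × Coord n) (𝓡 n).tangent ∞
      (fun z : Coord n × Coord n =>
        tangentMapWithin (𝓡 n) (𝓡 n) φ.symm φ.target ⟨z.1, z.2⟩) (Prod.fst ⁻¹' φ.target) := by
  have hmap := (contMDiffOn_symm_of_mem_maximalAtlas hφ).contMDiffOn_tangentMapWithin
    (m := ∞) (by simp) φ.open_target.uniqueMDiffOn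
  have hpair : ContMDiff 𝓘(ℝ, Coord n × Coord n) ((𝓡 n).prod 𝓘(ℝ, Coord n)) ∞
      fun z : Coord n × Coord n => (z.1, z.2) :=
    contDiff_fst.contMDiff.prodMk contDiff_snd.contMDiff
  rw [chartedSpaceSelf_prod] at hpair
  exact hmap.comp ((contMDiff_tangentBundleModelSpaceHomeomorph_symm (I := 𝓡 n) (n := ∞)).comp
    hpair).contMDiffOn fun z hz => hz

variable {F : TangentBundle (𝓡 n) M → ℝ} (hF : IsFinslerMetric F)
  (hφ : φ ∈ IsManifold.maximalAtlas (𝓡 n) ∞ M)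
include hF hφ

theorem contDiffAt_inCoords {x : Coord n} (hx : x ∈ φ.target) {y : Coord n} (hy : y ≠ 0) :
    ContDiffAt ℝ ∞ (Function.uncurry (inCoords φ F)) (x, y) := by
  let S : Set (Coord n × Coord n) := {z | z.1 ∈ φ.target ∧ z.2 ≠ 0}
  have hS : S ∈ nhds (x, y) := ((φ.open_target.preimage continuous_fst).inter
    (isOpen_ne.preimage continuous_snd)).mem_nhds ⟨hx, hy⟩
  have hderiv (z : Coord n × Coord n) (hz : z ∈ S) :
      mfderivWithin (𝓡 n) (𝓡 n) φ.symm φ.target z.1 = mfderiv (𝓡 n) (𝓡 n) φ.symm z.1 :=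
    mfderivWithin_of_isOpen φ.open_target hz.1
  have hcomp : ContMDiffOn 𝓘(ℝ, Coord n × Coord n) 𝓘(ℝ, ℝ) ∞ (fun z : Coord n × Coord n =>
      F (tangentMapWithin (𝓡 n) (𝓡 n) φ.symm φ.target ⟨z.1, z.2⟩)) S := by
    refine hF.smooth.comp ((contMDiffOn_tangentMapWithin_symm hφ).mono fun z hz => hz.1)
      fun z hz => ?_
    change mfderivWithin (𝓡 n) (𝓡 n) φ.symm φ.target z.1 z.2 ≠ 0
    rw [hderiv z hz]
    exact (map_ne_zero_iff _ (chartSymmDeriv hφ hz.1).injective).2 hz.2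
  refine ((contMDiffOn_iff_contDiffOn.1 hcomp).contDiffAt hS).congr_of_eventuallyEq ?_
  filter_upwards [hS] with z hz
  change F ⟨_, _⟩ = F ⟨φ.symm z.1, mfderivWithin (𝓡 n) (𝓡 n) φ.symm φ.target z.1 z.2⟩
  rw [hderiv z hz]

theorem contDiffAt_energy_inCoords {x : Coord n} (hx : x ∈ φ.target) {y : Coord n} (hy : y ≠ 0) :
    ContDiffAt ℝ ∞ (Function.uncurry fun x => energy (inCoords φ F x)) (x, y) :=
  contDiffAt_const.mul ((contDiffAt_inCoords hF hφ hx hy).pow 2)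

theorem isMinkowskiEnergy_energy_inCoords {x : Coord n} (hx : x ∈ φ.target) :
    IsMinkowskiEnergy (energy (inCoords φ F x)) := by
  let T := chartSymmDeriv hφ hx
  have hsmooth : SmoothOff (energy (inCoords φ F x)) := fun y hy =>
    (contDiffAt_energy_inCoords hF hφ hx hy).comp (f := fun y => (x, y)) y
      (contDiffAt_const.prodMk contDiffAt_id)
  have hfiber : energy (inCoords φ F x) ∘ T.symm = energy (fiber F (φ.symm x)) := by
    ext y
    simp [energy, inCoords_eq_fiber hφ F hx, T]
  have hE : IsMinkowskiEnergy (energy (fiber F (φ.symm x))) :=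
    isMinkowskiEnergy_energy (hfiber ▸ hsmooth.comp_equiv T.symm)
      (fun y t ht => hF.homogeneous _ y t ht) (hF.strongly_convex _)
  exact hE.comp_equiv T

theorem isFinslerEnergyAt_energy_inCoords {x : Coord n} (hx : x ∈ φ.target) :
    IsFinslerEnergyAt (fun x => energy (inCoords φ F x)) x :=
  .of_contDiffAt (fun _ hy => contDiffAt_energy_inCoords hF hφ hx hy)
    (isMinkowskiEnergy_energy_inCoords hF hφ hx)

end Charts

end FinslerConformal

theorem theorem5_general {n : ℕ} (hn : 3 ≤ n) {M : Type*} [TopologicalSpace M]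
    [ChartedSpace (EuclideanSpace ℝ (Fin n)) M] [IsManifold (𝓡 n) ∞ M]
    (F : TangentBundle (𝓡 n) M → ℝ) (hF : IsFinslerMetric F)
    (α : M → ℝ) (p : M) (hα : MDifferentiableAt (𝓡 n) 𝓘(ℝ, ℝ) α p)
    (φ : OpenPartialHomeomorph M (EuclideanSpace ℝ (Fin n)))
    (hφ : φ ∈ IsManifold.maximalAtlas (𝓡 n) ∞ M) (hpφ : p ∈ φ.source)
    (hP : ∀ v : TangentSpace (𝓡 n) p, v ≠ 0 → ∀ i j k : Fin n,
      ∑ l, mixedCurvature (inCoords φ (conformal α F)) l i j k (φ p) (vecCoords φ p v)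
          * dCoords φ α p l
        = ∑ l, mixedCurvature (inCoords φ F) l i j k (φ p) (vecCoords φ p v)
          * dCoords φ α p l) :
    (∃ c : ℝ, ∀ v : TangentSpace (𝓡 n) p, v ≠ 0 → mfderiv (𝓡 n) 𝓘(ℝ, ℝ) α p v = 0 →
      gradSq (inCoords φ F (φ p)) (dCoords φ α p) (vecCoords φ p v) = c) ∧
    (∃ c : ℝ, ∀ v : TangentSpace (𝓡 n) p, v ≠ 0 → mfderiv (𝓡 n) 𝓘(ℝ, ℝ) α p v = 0 →
      F ⟨p, v⟩ * gradDeriv (inCoords φ F (φ p)) (dCoords φ α p) (vecCoords φ p v) = c) := by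
  have hE := isFinslerEnergyAt_energy_inCoords hF hφ (φ.map_source hpφ)
  have hchart := mdifferentiable_of_mem_maximalAtlas hφ
  have hne (v : TangentSpace (𝓡 n) p) (hv : v ≠ 0) : vecCoords φ p v ≠ 0 :=
    (map_ne_zero_iff (mfderiv (𝓡 n) (𝓡 n) φ p) (hchart.mfderiv_injective hpφ)).2 hv
  have hker := fderiv_comp_symm_vecCoords hφ hα hpφ
  obtain ⟨q, hq⟩ := exists_isPolarization_of_sum_mixedCurvature_eq (by lia) hE
    (differentiableAt_comp_symm hφ hα hpφ) fun y hy i j k => by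
      obtain ⟨v, rfl⟩ := hchart.mfderiv_surjective hpφ y
      exact hP v (by rintro rfl; exact hy (map_zero _)) i j k
  obtain ⟨c₁, hc₁⟩ := exists_gradSq_comps_eq hn hE.isMinkowskiEnergy hq
  obtain ⟨c₂, hc₂⟩ := exists_mul_gradDeriv_comps_eq hn hE.isMinkowskiEnergy
    (fun _ => hF.nonneg _) hq
  refine ⟨⟨c₁, fun v hv hαv => hc₁ _ (hne v hv) ((hker v).trans hαv)⟩, ⟨c₂, fun v hv hαv => ?_⟩⟩
  rw [← inCoords_vecCoords hφ F hpφ v]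
  exact hc₂ _ (hne v hv) ((hker v).trans hαv)

theorem theorem5 {n : ℕ} (hn : 3 ≤ n) {M : Type*} [TopologicalSpace M]
    [ChartedSpace (EuclideanSpace ℝ (Fin n)) M] [IsManifold (𝓡 n) ∞ M]
    (F : TangentBundle (𝓡 n) M → ℝ) (hF : IsFinslerMetric F)
    (α : M → ℝ) (hα : ContMDiff (𝓡 n) 𝓘(ℝ, ℝ) ∞ α)
    (p : M) (hp : mfderiv (𝓡 n) 𝓘(ℝ, ℝ) α p ≠ 0)
    -- local coordinates around `p`
    (φ : OpenPartialHomeomorph M (EuclideanSpace ℝ (Fin n)))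
    (hφ : φ ∈ IsManifold.maximalAtlas (𝓡 n) ∞ M) (hpφ : p ∈ φ.source)
    -- the indicatrix at `p` has positive sectional curvature
    (hcurv : IndicatrixPositivelyCurved (inCoords φ F (φ p)))
    -- the contracted mixed curvatures of `e^α F` and `F` agree on the nonzero vectors at `p`
    (hP : ∀ v : TangentSpace (𝓡 n) p, v ≠ 0 → ∀ i j k : Fin n,
      ∑ l, mixedCurvature (inCoords φ (conformal α F)) l i j k (φ p) (vecCoords φ p v)
          * dCoords φ α p l
        = ∑ l, mixedCurvature (inCoords φ F) l i j k (φ p) (vecCoords φ p v)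
          * dCoords φ α p l) :
    (∃ c : ℝ, ∀ v : TangentSpace (𝓡 n) p, v ≠ 0 → mfderiv (𝓡 n) 𝓘(ℝ, ℝ) α p v = 0 →
      gradSq (inCoords φ F (φ p)) (dCoords φ α p) (vecCoords φ p v) = c) ∧
    (∃ c : ℝ, ∀ v : TangentSpace (𝓡 n) p, v ≠ 0 → mfderiv (𝓡 n) 𝓘(ℝ, ℝ) α p v = 0 →
      F ⟨p, v⟩ * gradDeriv (inCoords φ F (φ p)) (dCoords φ α p) (vecCoords φ p v) = c) :=
  theorem5_general hn F hF α p (hα.mdifferentiable (by simp) p) φ hφ hpφ hP
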